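/- **Uniqueness of the free higher-spin field equations.** Let $j\ge 1$ and let $V_j$ be the spin-$j$ irreducible representation of $SO(3)$, realised as the real symmetric traceless tensors $T^{a_1\dots a_j}$, $a_i\in\{0,1,2\}$. For $u\in\mathbb R^3$, $T\in V_j$ write $(u\star T)^{a_1\dots a_j}=\epsilon^{cd(a_1}u_cT_d{}^{a_2\dots a_j)}$ (sum over the $j$ positions of the free index on $\epsilon$, no normalisation factor), and let $\alpha\wedge_\star\beta$ and $\alpha\wedge_\times\beta$ be the wedge products of 1-forms built with $\star$ and with the cross product $(u\times w)^a=\epsilon^{abc}u_bw_c$. Let $U$ be a nonempty open region of three-dimensional spacetime $\mathbb R^3$, and let $E=(e,\omega)$ be a smooth background on $U$: an invertible dreibein $e^a$ and a spin connection $\omega^a$, both $\mathbb R^3$-valued 1-forms. For a smooth $g:U\to SO(3)$ let $g\cdot E=(ge,\ g\omega g^{-1}-dg\,g^{-1})$ (with $so(3)\cong\mathbb R^3$). For a pair $H=(H_e,H_\omega)$ of smooth $V_j$-valued 1-forms on $U$ and constant tensors $M,N$, i.e. linear maps $\mathbb R^3\oplus\mathbb R^3\to \mathrm{End}(V_j\oplus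 V_j)$, consider $$F_E(H)=dH+M\cdot E\wedge H,\qquad \delta_\Xi H=d\Xi+N\cdot E\,\Xi ,\qquad \Xi:U\to V_j\oplus V_j \text{ smooth}.$$ Assume: * ($SO(3)$-covariance) $F_{g\cdot E}(gH)=g\,F_E(H)$ for all smooth $g:U\to SO(3)$ and all $H$; * (parity covariance) $F_E(H)$ is mapped to its parity transform when $E$ and $H$ are, where parity is the pull-back by the reflection $(x^0,x^1,x^2)\mapsto(x^0,-x^1,x^2)$ combined with the intrinsic parities $e\to-e$, $\omega\to+\omega$, $H_e\to-H_e$, $H_\omega\to+H_\omega$; * (gauge invariance) in every local Lorentz frame, i.e. for each background $g\cdot E$ in place of $E$, $F(H+\delta_\Xi H)=F(H)$ for all $H$ and $\Xi$. Then: 1. $M=N$. 2. The background satisfies $N_a\,dE^a+N_aN_b\,E^a\wedge E^b=0$ on $U$. 3. The field equation $F_E(H)=0$ is the frame-like higher-spin equation: there are real constants $a,b$ such that, for all $H$, the two components of $F_E(H)$ are $$dH_e+\omega\wedge_\star H_e+a\,e\wedge_\star H_\omega ,\qquad dH_\omega+\omega\wedge_\star H_\omega+b\,e\wedge_\star H_e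 ,$$ and $M$ itself is given by $M(e,\omega)(h,k)=(\omega\star h+a\,e\star k,\ \omega\star k+b\,e\star h)$ for all $e,\omega\in\mathbb R^3$ and $h,k\in V_j$. 4. On $U$, $d\omega+\tfrac12\,\omega\wedge_\times\omega+\tfrac{ab}{2}\,e\wedge_\times e=0$, and if $(a,b)\ne(0,0)$ then $de+\omega\wedge_\times e=0$. 5. If $(M',N')$ satisfies the same assumptions on the same background, then $M'$ is of the form in 3 with constants $a',b'$ such that $a'b'=ab$; and if $ab\neq0$, then $M'$ is obtained from $M$ by rescaling $H_e\mapsto sH_e$ for some real $s\ne0$. -/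

import Mathlib

open scoped ContDiff Matrix

namespace FreeHS

/-! ### The spin-`j` irreducible representation of `SO(3)` -/

/-- The rotation group `SO(3)`. -/
abbrev SO3 : Type := Matrix.specialOrthogonalGroup (Fin 3) ℝ

/-- The vector representation (flat indices `a = 0, 1, 2`). -/
abbrev Vec : Type := Fin 3 → ℝ

/-- Tensors `T^{a₁ … a_j}` with `j` flat indices. -/
abbrev Tensor (j : ℕ) : Type := (Fin j → Fin 3) → ℝ

/-- The symmetric and traceless tensors with `j` indices: the spin-`j` irrep of `SO(3)`. -/
def spin (j : ℕ) : Submodule ℝ (Tensor j) where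
  carrier := {T | (∀ (σ : Equiv.Perm (Fin j)) (a : Fin j → Fin 3), T (a ∘ σ) = T a) ∧
    ∀ p q : Fin j, p ≠ q → ∀ a : Fin j → Fin 3,
      ∑ c, T (Function.update (Function.update a p c) q c) = 0}
  zero_mem' := by simp
  add_mem' := by
    rintro S T ⟨hS, hS'⟩ ⟨hT, hT'⟩
    refine ⟨fun σ a => by simp [hS, hT], fun p q h a => ?_⟩
    simp [Finset.sum_add_distrib, hS' p q h a, hT' p q h a]
  smul_mem' := by
    rintro r T ⟨hT, hT'⟩
    refine ⟨fun σ a => by simp [hT], fun p q h a => ?_⟩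
    simp [← Finset.mul_sum, hT' p q h a]

/-- The type of spin-`j` values. -/
abbrev Spin (j : ℕ) : Type := spin j

/-- The action of a matrix on tensors,
`(g T)^{a₁ … a_j} = ∑_b g_{a₁ b₁} ⋯ g_{a_j b_j} T^{b₁ … b_j}`. -/
def tensorAct (j : ℕ) (g : Matrix (Fin 3) (Fin 3) ℝ) : Tensor j →ₗ[ℝ] Tensor j where
  toFun T a := ∑ b : Fin j → Fin 3, (∏ i, g (a i) (b i)) * T b
  map_add' S T := by
    ext a
    simp [mul_add, Finset.sum_add_distrib]
  map_smul' r T := by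
    ext a
    simp only [Pi.smul_apply, smul_eq_mul, RingHom.id_apply, Finset.mul_sum]
    exact Finset.sum_congr rfl fun b _ => by ring

theorem tensorAct_apply (j : ℕ) (g : Matrix (Fin 3) (Fin 3) ℝ) (T : Tensor j)
    (a : Fin j → Fin 3) :
    tensorAct j g T a = ∑ b : Fin j → Fin 3, (∏ i, g (a i) (b i)) * T b := rfl

theorem sum_update {j : ℕ} (p : Fin j) (G : (Fin j → Fin 3) → ℝ) :
    ∑ b : Fin j → Fin 3, ∑ c : Fin 3, G (Function.update b p c)
      = 3 * ∑ b : Fin j → Fin 3, G b := by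
  have hinv : Function.Involutive
      (fun x : (Fin j → Fin 3) × Fin 3 => (Function.update x.1 p x.2, x.1 p)) := by
    rintro ⟨b, c⟩
    simp
  have h := Fintype.sum_equiv hinv.toPerm
    (fun x : (Fin j → Fin 3) × Fin 3 => G (Function.update x.1 p x.2))
    (fun x : (Fin j → Fin 3) × Fin 3 => G x.1) (fun x => rfl)
  rw [Fintype.sum_prod_type, Fintype.sum_prod_type] at h
  rw [h]
  simp [Finset.mul_sum]

theorem tensorAct_mem (j : ℕ) (g : SO3) {T : Tensor j} (hT : T ∈ spin j) :
    tensorAct j (g : Matrix (Fin 3) (Fin 3) ℝ) T ∈ spin j := by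
  obtain ⟨hsym, htr⟩ := hT
  have horth : ∀ x y : Fin 3, ∑ c, g.1 c x * g.1 c y = if x = y then 1 else 0 := by
    intro x y
    have h1 : (g.1)ᵀ * g.1 = 1 :=
      (Matrix.mem_orthogonalGroup_iff' _ _).1 (Matrix.mem_specialOrthogonalGroup_iff.1 g.2).1
    have h2 := congrFun (congrFun h1 x) y
    simpa [Matrix.mul_apply, Matrix.one_apply] using h2
  refine ⟨fun σ a => ?_, fun p q hpq a => ?_⟩
  · simp only [tensorAct_apply]
    refine Fintype.sum_equiv (Equiv.arrowCongr σ (Equiv.refl (Fin 3))) _ _ fun b => ?_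
    have h1 : (Equiv.arrowCongr σ (Equiv.refl (Fin 3))) b = b ∘ σ.symm := rfl
    rw [h1, hsym]
    congr 1
    refine Fintype.prod_equiv σ _ _ fun i => ?_
    simp
  · have hsplit : ∀ (c : Fin 3) (b : Fin j → Fin 3),
        ∏ i, g.1 (Function.update (Function.update a p c) q c i) (b i)
          = (∏ i ∈ (Finset.univ.erase p).erase q, g.1 (a i) (b i))
              * (g.1 c (b p) * g.1 c (b q)) := by
      intro c b
      rw [← Finset.mul_prod_erase Finset.univ _ (Finset.mem_univ p),
        ← Finset.mul_prod_erase (Finset.univ.erase p) _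
          (Finset.mem_erase.2 ⟨hpq.symm, Finset.mem_univ q⟩)]
      have h1 : ∏ i ∈ (Finset.univ.erase p).erase q,
          g.1 (Function.update (Function.update a p c) q c i) (b i)
          = ∏ i ∈ (Finset.univ.erase p).erase q, g.1 (a i) (b i) := by
        refine Finset.prod_congr rfl fun i hi => ?_
        simp only [Finset.mem_erase] at hi
        simp [Function.update_of_ne hi.1, Function.update_of_ne hi.2.1]
      rw [h1]
      simp [Function.update_of_ne hpq]
      ring
    set f : (Fin j → Fin 3) → ℝ :=
      fun b => ∏ i ∈ (Finset.univ.erase p).erase q, g.1 (a i) (b i) with hf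
    have hfu : ∀ b c, f (Function.update b p c) = f b ∧ f (Function.update b q c) = f b := by
      intro b c
      constructor <;> refine Finset.prod_congr rfl fun i hi => ?_ <;>
        simp only [Finset.mem_erase] at hi
      · rw [Function.update_of_ne hi.2.1]
      · rw [Function.update_of_ne hi.1]
    simp only [tensorAct_apply, hsplit]
    rw [Finset.sum_comm]
    have h1 : ∀ b : Fin j → Fin 3, ∑ c, f b * (g.1 c (b p) * g.1 c (b q)) * T b
        = if b p = b q then f b * T b else 0 := by
      intro b
      rw [← Finset.sum_mul, ← Finset.mul_sum, horth]
      split_ifs <;> simp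
    rw [Finset.sum_congr rfl fun b _ => h1 b]
    have h2 := sum_update p (fun b => if b p = b q then f b * T b else 0)
    have h3 : ∀ b : Fin j → Fin 3, (∑ c : Fin 3, if (Function.update b p c) p
        = (Function.update b p c) q then f (Function.update b p c) * T (Function.update b p c)
        else 0) = f b * T (Function.update b p (b q)) := by
      intro b
      simp [Function.update_of_ne hpq.symm, (hfu b _).1]
    have h4 := sum_update q (fun b => f b * T (Function.update b p (b q)))
    have h5 : ∀ b : Fin j → Fin 3, (∑ c : Fin 3, f (Function.update b q c)
        * T (Function.update (Function.update b q c) p (Function.update b q c q))) = 0 := by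
      intro b
      simp only [(hfu b _).2, Function.update_self, ← Finset.mul_sum]
      rw [htr q p hpq.symm b, mul_zero]
    rw [Finset.sum_congr rfl fun b _ => h3 b] at h2
    rw [Finset.sum_congr rfl fun b _ => h5 b] at h4
    simp only [Finset.sum_const_zero] at h4
    linarith

/-- The spin-`j` representation of `SO(3)` on symmetric traceless tensors. -/
def rep (j : ℕ) : Representation ℝ SO3 (Spin j) where
  toFun g := (tensorAct j (g : Matrix (Fin 3) (Fin 3) ℝ)).restrict
    (fun _ hT => tensorAct_mem j g hT)
  map_one' := by
    ext T a
    have h : ∀ b : Fin j → Fin 3, (∏ i, (1 : Matrix (Fin 3) (Fin 3) ℝ) (a i) (b i))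
        = if a = b then 1 else 0 := by
      intro b
      split_ifs with hab
      · subst hab
        simp
      · obtain ⟨i, hi⟩ := Function.ne_iff.1 hab
        exact Finset.prod_eq_zero (Finset.mem_univ i) (Matrix.one_apply_ne hi)
    simp [LinearMap.restrict_apply, tensorAct_apply, h]
  map_mul' g h := by
    ext T a
    simp only [LinearMap.restrict_apply, tensorAct_apply, Module.End.mul_apply,
      Submonoid.coe_mul, Matrix.mul_apply, Finset.prod_univ_sum, Fintype.piFinset_univ,
      Finset.mul_sum, Finset.sum_mul, Finset.prod_mul_distrib]
    rw [Finset.sum_comm]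
    exact Finset.sum_congr rfl fun b _ => Finset.sum_congr rfl fun c _ => by ring

/-- The contraction `ε^{c d (a₁} u_c T_d^{a₂ … a_j)}` (sum over the `j` positions of the free
index on `ε`): for each slot `i` the cross product `u × T` is taken in the `i`-th index of `T`.
On `Spin j` it is also the infinitesimal action of the rotation generator `u ×`. -/
def tensorEps (j : ℕ) : Vec →ₗ[ℝ] Tensor j →ₗ[ℝ] Tensor j :=
  LinearMap.mk₂ ℝ
    (fun u T a => ∑ i, (crossProduct u (fun d => T (Function.update a i d))) (a i))
    (fun u v T => by ext a; simp [Finset.sum_add_distrib])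
    (fun r u T => by ext a; simp [Finset.mul_sum])
    (fun u S T => by
      ext a
      simp only [Pi.add_apply, ← Finset.sum_add_distrib]
      refine Finset.sum_congr rfl fun i _ => ?_
      rw [← Pi.add_apply, ← map_add]
      rfl)
    (fun r u T => by
      ext a
      simp only [Pi.smul_apply, Finset.smul_sum]
      refine Finset.sum_congr rfl fun i _ => ?_
      rw [← Pi.smul_apply, ← map_smul]
      rfl)

theorem tensorEps_apply (j : ℕ) (u : Vec) (T : Tensor j) (a : Fin j → Fin 3) :
    tensorEps j u T a
      = ∑ i, (crossProduct u (fun d => T (Function.update a i d))) (a i) := rfl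

theorem tensorEps_mem (j : ℕ) (u : Vec) {T : Tensor j} (hT : T ∈ spin j) :
    tensorEps j u T ∈ spin j := by
  obtain ⟨hsym, htr⟩ := hT
  refine ⟨fun σ a => ?_, fun p q hpq a => ?_⟩
  · simp only [tensorEps_apply]
    refine Fintype.sum_equiv σ _ _ fun i => ?_
    have h : ∀ d, T (Function.update (a ∘ σ) i d) = T (Function.update a (σ i) d) := by
      intro d
      rw [← hsym σ (Function.update a (σ i) d), Function.update_comp_eq_of_injective _ σ.injective]
    simp [h]
  · simp only [tensorEps_apply]
    rw [Finset.sum_comm, ← Finset.add_sum_erase Finset.univ _ (Finset.mem_univ p),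
      ← Finset.add_sum_erase (Finset.univ.erase p) _
        (Finset.mem_erase.2 ⟨hpq.symm, Finset.mem_univ q⟩)]
    have h0 : ∑ i ∈ (Finset.univ.erase p).erase q, ∑ c : Fin 3,
        (crossProduct u (fun d => T (Function.update
          (Function.update (Function.update a p c) q c) i d)))
          (Function.update (Function.update a p c) q c i) = 0 := by
      refine Finset.sum_eq_zero fun i hi => ?_
      simp only [Finset.mem_erase] at hi
      have h1 : ∀ c d, Function.update (Function.update (Function.update a p c) q c) i d
          = Function.update (Function.update (Function.update a i d) p c) q c := by
        intro c d
        rw [Function.update_comm hi.1.symm, Function.update_comm hi.2.1.symm]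
      simp only [h1, Function.update_of_ne hi.1, Function.update_of_ne hi.2.1]
      rw [← Finset.sum_apply, ← map_sum]
      have h2 : (∑ c : Fin 3, fun d => T (Function.update
          (Function.update (Function.update a i d) p c) q c)) = 0 := by
        ext d
        simpa using htr p q hpq (Function.update a i d)
      rw [h2]
      simp
    rw [h0, add_zero]
    have hs : ∀ c d, T (Function.update (Function.update a p c) q d)
        = T (Function.update (Function.update a p d) q c) := by
      intro c d
      rw [← hsym (Equiv.swap p q) (Function.update (Function.update a p d) q c)]
      congr 1
      ext i
      by_cases h1 : i = p
      · subst h1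
        simp [Function.update_of_ne hpq]
      · by_cases h2 : i = q
        · subst h2
          simp [Function.update_of_ne hpq]
        · simp [Function.update_of_ne h1, Function.update_of_ne h2,
            Equiv.swap_apply_of_ne_of_ne h1 h2]
    have hp : ∀ c d, Function.update (Function.update (Function.update a p c) q c) p d
        = Function.update (Function.update a p d) q c := by
      intro c d
      rw [Function.update_comm hpq.symm, Function.update_idem]
    simp only [hp, Function.update_idem, Function.update_self, Function.update_of_ne hpq]
    simp only [cross_apply, Fin.sum_univ_three, Matrix.cons_val]
    rw [hs 1 0, hs 2 0, hs 2 1]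
    ring

/-- `eps j u T` is `ε^{c d (a₁} u_c T_d^{a₂ … a_j)}` on symmetric traceless tensors. -/
def eps (j : ℕ) : Vec →ₗ[ℝ] Spin j →ₗ[ℝ] Spin j :=
  LinearMap.mk₂ ℝ (fun u T => ⟨tensorEps j u T.1, tensorEps_mem j u T.2⟩)
    (fun u v T => by ext a; simp)
    (fun r u T => by ext a; simp)
    (fun u S T => by ext a; simp)
    (fun r u T => by ext a; simp)

/-! ### Vector-valued differential forms on three-dimensional spacetime -/

/-- Three-dimensional spacetime (fields live on an open subset of it). -/
abbrev Spacetime : Type := EuclideanSpace ℝ (Fin 3)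

/-- `V`-valued 1-forms. -/
abbrev OneForm (V : Type) [NormedAddCommGroup V] [NormedSpace ℝ V] : Type :=
  Spacetime → Spacetime →L[ℝ] V

section Forms

variable {V W A : Type} [NormedAddCommGroup V] [NormedSpace ℝ V]
  [NormedAddCommGroup W] [NormedSpace ℝ W] [NormedAddCommGroup A] [NormedSpace ℝ A]

/-- The exterior derivative of a 1-form, evaluated at the point `x` on the vectors `v, w`. -/
noncomputable def d (H : OneForm V) (x v w : Spacetime) : V :=
  extDeriv (fun y => ContinuousAlternatingMap.ofSubsingleton ℝ Spacetime V (0 : Fin 1) (H y))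
    x ![v, w]

theorem d_apply (H : OneForm V) (x v w : Spacetime) (hH : DifferentiableAt ℝ H x) :
    d H x v w = fderiv ℝ H x v w - fderiv ℝ H x w v := by
  have h : HasFDerivAt
      (fun y => ContinuousAlternatingMap.ofSubsingleton ℝ Spacetime V (0 : Fin 1) (H y))
      ((ContinuousAlternatingMap.ofSubsingletonLIE (𝕜 := ℝ) (E := Spacetime)
        (F := V) (0 : Fin 1)).toContinuousLinearEquiv.toContinuousLinearMap.comp (fderiv ℝ H x)) x :=
    ((ContinuousAlternatingMap.ofSubsingletonLIE (𝕜 := ℝ) (E := Spacetime)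
      (F := V) (0 : Fin 1)).toContinuousLinearEquiv.toContinuousLinearMap.hasFDerivAt).comp x
      hH.hasFDerivAt
  rw [d, extDeriv, h.fderiv]
  simp [ContinuousAlternatingMap.alternatizeUncurryFin_apply, Fin.sum_univ_two,
    Fin.removeNth, ContinuousAlternatingMap.ofSubsingletonLIE]
  exact (sub_eq_add_neg _ _).symm

/-- The wedge product of 1-forms `α ∧ β` with respect to a bilinear pairing `B` of their values,
evaluated at the point `x` on the vectors `v, w`. -/
def wedge (B : A →ₗ[ℝ] V →ₗ[ℝ] W) (α : OneForm A) (β : OneForm V) (x v w : Spacetime) : W :=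
  B (α x v) (β x w) - B (α x w) (β x v)

/-- First component of a pair of 1-forms. -/
def OneForm.fst (H : OneForm (V × W)) : OneForm V :=
  fun x => (ContinuousLinearMap.fst ℝ V W).comp (H x)

/-- Second component of a pair of 1-forms. -/
def OneForm.snd (H : OneForm (V × W)) : OneForm W :=
  fun x => (ContinuousLinearMap.snd ℝ V W).comp (H x)

/-- The intrinsic parity assignment `(odd, even) ↦ (-odd, even)`. -/
def parity : (V × W) →L[ℝ] (V × W) :=
  (-ContinuousLinearMap.fst ℝ V W).prod (ContinuousLinearMap.snd ℝ V W)

/-- The spacetime reflection `(x⁰, x¹, x²) ↦ (x⁰, -x¹, x²)`. -/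
noncomputable def reflect : Spacetime ≃ₗᵢ[ℝ] Spacetime :=
  ((ℝ ∙ (EuclideanSpace.single 1 1 : Spacetime))ᗮ).reflection

/-- The parity transform of a pair of 1-forms: intrinsic parity on top of the pull-back by the
spacetime reflection. If the pair lives on `U`, its parity transform lives on `reflect ⁻¹' U`. -/
noncomputable def parityForm (H : OneForm (V × W)) : OneForm (V × W) :=
  fun x => (parity.comp (H (reflect x))).comp
    (reflect.toContinuousLinearEquiv : Spacetime →L[ℝ] Spacetime)

end Forms

/-! ### Backgrounds, field equations and gauge transformations -/

/-- A background `E = (e, ω)`: dreibein `e^a` and spin connection `ω^a`. -/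
abbrev Background : Type := OneForm (Vec × Vec)

/-- Pairs `(H_e, H_ω)` of spin-`j` values. -/
abbrev Pair (j : ℕ) : Type := Spin j × Spin j

/-- Spacetime-constant tensors `M^A_{a B}`. -/
abbrev Coupling (j : ℕ) : Type := (Vec × Vec) →ₗ[ℝ] Pair j →ₗ[ℝ] Pair j

/-- A local rotation `g : U → SO(3)` is smooth. -/
def IsSmoothRotation (U : Set Spacetime) (g : Spacetime → SO3) : Prop :=
  ∀ a b : Fin 3, ContDiffOn ℝ ∞ (fun x => (g x).1 a b) U

/-- The vector `u` with `A = u ×`, for an antisymmetric matrix `A`. -/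
def axial : Matrix (Fin 3) (Fin 3) ℝ →ₗ[ℝ] Vec where
  toFun A := ![A 2 1, A 0 2, A 1 0]
  map_add' A B := by simp
  map_smul' r A := by simp

/-- The matrix-valued 1-form `dg g⁻¹`. -/
noncomputable def maurerCartan (g : Spacetime → SO3) (x : Spacetime) :
    Spacetime →ₗ[ℝ] Matrix (Fin 3) (Fin 3) ℝ where
  toFun v := Matrix.of (fun a b => fderiv ℝ (fun y => (g y).1 a b) x v) * ((g x).1)ᵀ
  map_add' v w := by
    rw [← add_mul]
    congr 1
    ext a b
    simp
  map_smul' r v := by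
    rw [RingHom.id_apply, ← smul_mul_assoc]
    congr 1
    ext a b
    simp

/-- Background gauge transformation by the local rotation `g`: the dreibein transforms as a vector,
`e ↦ g e`, and the spin connection as a connection, `ω ↦ g ω g⁻¹ - dg g⁻¹`, where `so(3)` is
identified with vectors. -/
noncomputable def rotateBackground (g : Spacetime → SO3) (E : Background) : Background :=
  fun x => LinearMap.toContinuousLinearMap
    { toFun := fun v => ((g x).1 *ᵥ (E x v).1, (g x).1 *ᵥ (E x v).2 - axial (maurerCartan g x v))
      map_add' := fun v w => by
        simp only [map_add, Prod.fst_add, Prod.snd_add, Matrix.mulVec_add, Prod.mk_add_mk]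
        congr 1
        abel
      map_smul' := fun r v => by
        simp only [map_smul, Prod.smul_fst, Prod.smul_snd, Matrix.mulVec_smul, Prod.smul_mk,
          smul_sub, RingHom.id_apply] }

/-- The action of `SO(3)` on pairs of spin-`j` values. -/
def pairRep (j : ℕ) (g : SO3) : Pair j →ₗ[ℝ] Pair j := (rep j g).prodMap (rep j g)

/-- The perturbation `H` transforms tensorially under the local rotation `g`. -/
noncomputable def rotateField {j : ℕ} (g : Spacetime → SO3) (H : OneForm (Pair j)) :
    OneForm (Pair j) :=
  fun x => (LinearMap.toContinuousLinearMap (pairRep j (g x))).comp (H x)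

/-- The left-hand side `F(H) = dH + M · E ∧ H` of the field equation, a 2-form. -/
noncomputable def fieldEq {j : ℕ} (M : Coupling j) (E : Background) (H : OneForm (Pair j))
    (x v w : Spacetime) : Pair j :=
  d H x v w + wedge M E H x v w

/-- The gauge variation `δ_Ξ H = dΞ + N · E Ξ`. -/
noncomputable def gaugeVariation {j : ℕ} (N : Coupling j) (E : Background)
    (Ξ : Spacetime → Pair j) : OneForm (Pair j) :=
  fun x => fderiv ℝ Ξ x +
    LinearMap.toContinuousLinearMap ((N.flip (Ξ x)).comp (E x : Spacetime →ₗ[ℝ] Vec × Vec))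

/-- Covariance under local `SO(3)`: rotating the perturbation and the background rotates `F(H)`. -/
def IsSO3Covariant {j : ℕ} (U : Set Spacetime) (E : Background) (M : Coupling j) : Prop :=
  ∀ g : Spacetime → SO3, IsSmoothRotation U g →
    ∀ H : OneForm (Pair j), ContDiffOn ℝ ∞ H U → ∀ x ∈ U, ∀ v w : Spacetime,
      fieldEq M (rotateBackground g E) (rotateField g H) x v w
        = pairRep j (g x) (fieldEq M E H x v w)

/-- Covariance under parity: `F` of the parity-transformed fields is the parity transform of
`F(H)`, with the same intrinsic parities as `H` itself. -/
def IsParityCovariant {j : ℕ} (U : Set Spacetime) (E : Background) (M : Coupling j) : Prop :=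
  ∀ H : OneForm (Pair j), ContDiffOn ℝ ∞ H U → ∀ x ∈ reflect ⁻¹' U, ∀ v w : Spacetime,
    fieldEq M (parityForm E) (parityForm H) x v w
      = parity (fieldEq M E H (reflect x) (reflect v) (reflect w))

/-- Invariance of the field equation under `H ↦ H + δ_Ξ H` for all gauge parameters `Ξ`. -/
def IsGaugeInvariant {j : ℕ} (U : Set Spacetime) (E : Background) (M N : Coupling j) : Prop :=
  ∀ H : OneForm (Pair j), ContDiffOn ℝ ∞ H U →
    ∀ Ξ : Spacetime → Pair j, ContDiffOn ℝ ∞ Ξ U → ∀ x ∈ U, ∀ v w : Spacetime,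
      fieldEq M E (H + gaugeVariation N E Ξ) x v w = fieldEq M E H x v w

/-- `dH + M · E ∧ H = 0` is an `SO(3)`- and parity-covariant linear equation with the gauge
invariance `δH = dΞ + N · E Ξ`. The gauge invariance holds in every local Lorentz frame, that is
for every background obtained from `E` by a local rotation. -/
structure IsGaugeSystem {j : ℕ} (U : Set Spacetime) (E : Background) (M N : Coupling j) :
    Prop where
  so3_covariant : IsSO3Covariant U E M
  parity_covariant : IsParityCovariant U E M
  gauge_invariant : ∀ g : Spacetime → SO3, IsSmoothRotation U g →
    IsGaugeInvariant U (rotateBackground g E) M N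

/-- The background equation `N_a dE^a + N_a N_b E^a ∧ E^b = 0`. -/
def BackgroundEq {j : ℕ} (U : Set Spacetime) (E : Background) (N : Coupling j) : Prop :=
  ∀ x ∈ U, ∀ v w : Spacetime,
    N (d E x v w) + (N (E x v) ∘ₗ N (E x w) - N (E x w) ∘ₗ N (E x v)) = 0

/-- The torsion 2-form `de^a + ε^{abc} ω_b ∧ e_c`. -/
noncomputable def torsion (E : Background) (x v w : Spacetime) : Vec :=
  d E.fst x v w + wedge crossProduct E.snd E.fst x v w

/-- The curvature 2-form `dω^a + ½ ε^{abc} ω_b ∧ ω_c`. -/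
noncomputable def curvature (E : Background) (x v w : Spacetime) : Vec :=
  d E.snd x v w + (1 / 2 : ℝ) • wedge crossProduct E.snd E.snd x v w

/-- The `SO(3)`-covariant exterior derivative `D̄h = dh + ε^{cd(a₁} ω_c ∧ h_d^{a₂ … a_j)}` of a
spin-`j` 1-form. -/
noncomputable def covD {j : ℕ} (E : Background) (h : OneForm (Spin j)) (x v w : Spacetime) :
    Spin j :=
  d h x v w + wedge (eps j) E.snd h x v w

/-- The left-hand sides of the frame-like higher-spin equations,
`D̄H_e + a ε^{cd(a₁} e_c ∧ (H_ω)_d^{a₂ … a_j)}` and `D̄H_ω + b ε^{cd(a₁} e_c ∧ (H_e)_d^{a₂ … a_j)}`. -/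
noncomputable def frameLikeEq {j : ℕ} (a b : ℝ) (E : Background) (H : OneForm (Pair j))
    (x v w : Spacetime) : Pair j :=
  (covD E H.fst x v w + a • wedge (eps j) E.fst H.snd x v w,
    covD E H.snd x v w + b • wedge (eps j) E.fst H.fst x v w)

/-- `M` is the tensor of the frame-like higher-spin equations with constants `a, b` (here `e`, `w` are
values of the dreibein and the spin connection, `h`, `k` values of `H_e`, `H_ω`). -/
def IsFrameLike {j : ℕ} (a b : ℝ) (M : Coupling j) : Prop :=
  ∀ (e w : Vec) (h k : Spin j),
    M (e, w) (h, k) = (eps j w h + a • eps j e k, eps j w k + b • eps j e h)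

end FreeHS

namespace FreeHS

/-! ### Components of symmetric traceless tensors -/

/-! All information is extracted at single points `x`, with test fields whose value and first
derivative at `x` can be prescribed independently.

Covariance is tested on constant `H` and on rotations about a coordinate axis by an affine angle `c
+ l (y - x)`. At `c = 0` only the inhomogeneous shift of `ω` survives, which forces `M (0, w)` to be
the infinitesimal rotation by `w` (`coupling_connection`). At `l = 0`, differentiating in `c` shows
that `e ↦ M (e, 0)` is rotation-equivariant (`coupling_vector`). Each of its four `V_j → V_j` blocks
is then a vector operator, hence a multiple of the rotation generators (`exists_eq_smul_rotGen`).
Parity kills the two diagonal blocks; the other two supply `a` and `b` (`exists_isFrameLike`).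

The classification of vector operators is algebraic. By Schur's lemma (`exists_eq_smul_one`) the
Casimir `C` and `L · V` are scalars. Expanding `[C, V] = 0` gives `V = L × V`, whence `C V = L (L ·
V)`, and `C = -j (j + 1)` is nonzero. Schur's lemma itself rests on the component `T^{2…2}`: it
determines a tensor invariant about the last axis, and no nonzero invariant subspace lies in its
kernel.

Gauge invariance is tested on affine `Ξ` (`IsGaugeInvariant.affine`). The slope of `Ξ` gives `M = N`
on the values of the background, extended to all arguments by changing frame; the constant part
gives the background equation. In frame-like form this equation splits into curvature and torsion,
because the generators act faithfully (`rotGen_injective`). Since `e` is invertible, `e ∧ e` does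
not vanish, so the curvature fixes `a * b`. -/

/-- The number of indices of the multi-index `a` equal to `c`. -/
def count {j : ℕ} (a : Fin j → Fin 3) (c : Fin 3) : ℕ :=
  (Finset.univ.filter fun i => a i = c).card

/-- The sorted multi-index with `p` zeros, `q` ones, and twos in the remaining slots. -/
def sortedIndex (j p q : ℕ) (i : Fin j) : Fin 3 :=
  if i.1 < p then 0 else if i.1 < p + q then 1 else 2

/-- The component of a tensor with `p` indices `0`, `q` indices `1`, the others being `2`. -/
def component {j : ℕ} (T : Tensor j) (p q : ℕ) : ℝ := T (sortedIndex j p q)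

theorem count_update {j : ℕ} (a : Fin j → Fin 3) (i : Fin j) (d c : Fin 3) :
    count (Function.update a i d) c + (if a i = c then 1 else 0)
      = count a c + (if d = c then 1 else 0) := by
  simp only [count, Finset.card_filter]
  rw [← Finset.add_sum_erase _ _ (Finset.mem_univ i),
    ← Finset.add_sum_erase (Finset.univ) (fun k => if a k = c then 1 else 0) (Finset.mem_univ i)]
  have h : ∑ x ∈ Finset.univ.erase i, (if Function.update a i d x = c then 1 else 0)
      = ∑ x ∈ Finset.univ.erase i, (if a x = c then 1 else 0) :=
    Finset.sum_congr rfl fun x hx => by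
      rw [Function.update_of_ne (Finset.ne_of_mem_erase hx)]
  rw [h, Function.update_self]
  ring

theorem one_le_count {j : ℕ} (a : Fin j → Fin 3) (i : Fin j) : 1 ≤ count a (a i) :=
  Finset.card_pos.2 ⟨i, by simp⟩

theorem count_total {j : ℕ} (a : Fin j → Fin 3) : count a 0 + count a 1 + count a 2 = j := by
  have h := Finset.card_eq_sum_card_fiberwise (f := a) (s := Finset.univ) (t := Finset.univ)
    (fun _ _ => Finset.mem_coe.2 (Finset.mem_univ _))
  simpa [Fin.sum_univ_three, count] using h.symm

/-- Fibres over the same value have equal cardinality, so bijections between them glue to a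
permutation of the slots. A symmetric tensor thus depends only on the counts. -/
theorem exists_perm_of_count_eq {j : ℕ} {a b : Fin j → Fin 3} (h : ∀ c, count a c = count b c) :
    ∃ σ : Equiv.Perm (Fin j), a = b ∘ σ := by
  have h1 : ∀ c, Nonempty ({i // a i = c} ≃ {i // b i = c}) := fun c =>
    ⟨Fintype.equivOfCardEq (by
      have := h c
      simpa [count, Fintype.card_subtype] using this)⟩
  have e := fun c => (h1 c).some
  exact ⟨Equiv.ofFiberEquiv e, funext fun i => (Equiv.ofFiberEquiv_map e i).symm⟩

theorem count_sortedIndex {j p q : ℕ} (h : p + q ≤ j) :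
    count (sortedIndex j p q) 0 = p ∧ count (sortedIndex j p q) 1 = q := by
  have h0 : count (sortedIndex j p q) 0 = p := by
    have h1 : ∀ i : Fin j, sortedIndex j p q i = 0 ↔ i.1 < p := by
      intro i
      unfold sortedIndex
      split_ifs <;> simp_all
    simp only [count, h1]
    rw [Fin.card_filter_val_lt]
    omega
  have h2 : count (sortedIndex j p q) 2 = j - (p + q) := by
    have h1 : ∀ i : Fin j, sortedIndex j p q i = 2 ↔ p + q ≤ i.1 := by
      intro i
      unfold sortedIndex
      split_ifs <;> simp <;> omega
    have h3 := Finset.card_filter_add_card_filter_not (s := (Finset.univ : Finset (Fin j)))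
      (fun i => i.1 < p + q)
    rw [Fin.card_filter_val_lt] at h3
    simp only [not_lt, Finset.card_univ, Fintype.card_fin] at h3
    simp only [count, h1]
    omega
  have := count_total (sortedIndex j p q)
  exact ⟨h0, by omega⟩

theorem apply_eq_component {j : ℕ} {T : Tensor j} (hT : T ∈ spin j) (a : Fin j → Fin 3) :
    T a = component T (count a 0) (count a 1) := by
  have ht := count_total a
  obtain ⟨h0, h1⟩ := count_sortedIndex (j := j) (p := count a 0) (q := count a 1) (by omega)
  have ht' := count_total (sortedIndex j (count a 0) (count a 1))
  obtain ⟨σ, hσ⟩ := exists_perm_of_count_eq (a := a)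
    (b := sortedIndex j (count a 0) (count a 1)) (by
      intro c
      fin_cases c
      · exact h0.symm
      · exact h1.symm
      · change count a 2 = count _ 2
        omega)
  conv_lhs => rw [hσ]
  exact hT.1 σ _

theorem eq_zero_of_component {j : ℕ} {T : Tensor j} (hT : T ∈ spin j)
    (h : ∀ p q, p + q ≤ j → component T p q = 0) : T = 0 := by
  ext a
  have := count_total a
  rw [apply_eq_component hT, h _ _ (by omega)]
  rfl

theorem component_update {j : ℕ} {T : Tensor j} (hT : T ∈ spin j) (a : Fin j → Fin 3)
    (i : Fin j) (d : Fin 3) {p q : ℕ}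
    (hp : p + (if a i = 0 then 1 else 0) = count a 0 + (if d = 0 then 1 else 0))
    (hq : q + (if a i = 1 then 1 else 0) = count a 1 + (if d = 1 then 1 else 0)) :
    T (Function.update a i d) = component T p q := by
  have h0 := count_update a i d 0
  have h1 := count_update a i d 1
  rw [apply_eq_component hT]
  congr 1 <;> omega

/-- Groups slots by index value; this is where the integer coefficients in the component formulas
for the generators come from. -/
theorem sum_by_value {j : ℕ} (a : Fin j → Fin 3) (f : Fin j → ℝ) (x : Fin 3 → ℝ)
    (h : ∀ i, f i = x (a i)) :
    ∑ i, f i = count a 0 * x 0 + count a 1 * x 1 + count a 2 * x 2 := by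
  have h1 : ∀ i, f i = ∑ c, if a i = c then x c else 0 := by
    intro i
    simp [h]
  simp only [h1]
  rw [Finset.sum_comm]
  simp [Fin.sum_univ_three, count, ← Finset.sum_filter]

/-! ### Rotation generators and the trace condition in components -/

/-- The truncated subtractions are harmless: `p - 1` at `p = 0` and `q - 1` at `q = 0` come with
coefficient zero. In the two formulas that follow, `j - p - q` likewise kills the components with
too many indices. -/
theorem component_eps_two {j : ℕ} {T : Tensor j} (hT : T ∈ spin j) {p q : ℕ} (h : p + q ≤ j) :
    component (tensorEps j ![0, 0, 1] T) p q
      = -(p * component T (p - 1) (q + 1)) + q * component T (p + 1) (q - 1) := by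
  obtain ⟨h0, h1⟩ := count_sortedIndex h
  rw [component, tensorEps_apply, sum_by_value (sortedIndex j p q) _
    ![-component T (p - 1) (q + 1), component T (p + 1) (q - 1), 0], h0, h1]
  · simp
  intro i
  have hu := component_update hT (sortedIndex j p q) i
  have hc := one_le_count (sortedIndex j p q) i
  rw [h0, h1] at hu
  generalize sortedIndex j p q i = c at *
  fin_cases c <;> simp [cross_apply]
  · change 1 ≤ count _ 0 at hc
    exact hu 1 (by simp; omega) (by simp)
  · change 1 ≤ count _ 1 at hc
    exact hu 0 (by simp) (by simp; omega)

theorem component_eps_zero {j : ℕ} {T : Tensor j} (hT : T ∈ spin j) {p q : ℕ} (h : p + q ≤ j) :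
    component (tensorEps j ![1, 0, 0] T) p q
      = -(q * component T p (q - 1)) + (j - p - q) * component T p (q + 1) := by
  obtain ⟨h0, h1⟩ := count_sortedIndex h
  have h2 : (count (sortedIndex j p q) 2 : ℝ) = j - p - q := by
    have h3 := count_total (sortedIndex j p q)
    rw [h0, h1] at h3
    have h4 := congrArg (Nat.cast : ℕ → ℝ) h3
    push_cast at h4
    linarith
  rw [component, tensorEps_apply, sum_by_value (sortedIndex j p q) _
    ![0, -component T p (q - 1), component T p (q + 1)], h0, h1, h2]
  · simp
  intro i
  have hu := component_update hT (sortedIndex j p q) i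
  have hc := one_le_count (sortedIndex j p q) i
  rw [h0, h1] at hu
  generalize sortedIndex j p q i = c at *
  fin_cases c <;> simp [cross_apply]
  · change 1 ≤ count _ 1 at hc
    exact hu 2 (by simp) (by simp; omega)
  · exact hu 1 (by simp) (by simp)

theorem component_eps_one {j : ℕ} {T : Tensor j} (hT : T ∈ spin j) {p q : ℕ} (h : p + q ≤ j) :
    component (tensorEps j ![0, 1, 0] T) p q
      = p * component T (p - 1) q - (j - p - q) * component T (p + 1) q := by
  obtain ⟨h0, h1⟩ := count_sortedIndex h
  have h2 : (count (sortedIndex j p q) 2 : ℝ) = j - p - q := by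
    have h3 := count_total (sortedIndex j p q)
    rw [h0, h1] at h3
    have h4 := congrArg (Nat.cast : ℕ → ℝ) h3
    push_cast at h4
    linarith
  rw [component, tensorEps_apply, sum_by_value (sortedIndex j p q) _
    ![component T (p - 1) q, 0, -component T (p + 1) q], h0, h1, h2]
  · simp
    ring
  intro i
  have hu := component_update hT (sortedIndex j p q) i
  have hc := one_le_count (sortedIndex j p q) i
  rw [h0, h1] at hu
  generalize sortedIndex j p q i = c at *
  fin_cases c <;> simp [cross_apply]
  · change 1 ≤ count _ 0 at hc
    exact hu 2 (by simp; omega) (by simp)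
  · exact hu 0 (by simp) (by simp)

theorem component_trace {j : ℕ} {T : Tensor j} (hT : T ∈ spin j) {p q : ℕ} (h : p + q + 2 ≤ j) :
    component T (p + 2) q + component T p (q + 2) + component T p q = 0 := by
  have h01 : (⟨j - 1, by omega⟩ : Fin j) ≠ ⟨j - 2, by omega⟩ := by
    simp only [ne_eq, Fin.mk.injEq]
    omega
  set x : Fin j := ⟨j - 1, by omega⟩ with hx
  set y : Fin j := ⟨j - 2, by omega⟩ with hy
  have ht := hT.2 x y h01 (sortedIndex j p q)
  obtain ⟨h0, h1⟩ := count_sortedIndex (j := j) (p := p) (q := q) (by omega)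
  -- The last two slots of the sorted index hold twos because `p + q + 2 ≤ j`; the trace is taken
  -- over them.
  have ax : sortedIndex j p q x = 2 := by
    simp only [sortedIndex, hx]
    rw [if_neg (by omega), if_neg (by omega)]
  have ay : sortedIndex j p q y = 2 := by
    simp only [sortedIndex, hy]
    rw [if_neg (by omega), if_neg (by omega)]
  have hu : ∀ c, T (Function.update (Function.update (sortedIndex j p q) x c) y c)
      = component T (p + if c = 0 then 2 else 0) (q + if c = 1 then 2 else 0) := by
    intro c
    have c0 := count_update (sortedIndex j p q) x c 0
    have c1 := count_update (sortedIndex j p q) x c 1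
    have d0 := count_update (Function.update (sortedIndex j p q) x c) y c 0
    have d1 := count_update (Function.update (sortedIndex j p q) x c) y c 1
    rw [ax] at c0 c1
    rw [Function.update_of_ne h01.symm, ay] at d0 d1
    rw [apply_eq_component hT]
    fin_cases c <;> simp at * <;> congr 1 <;> omega
  simp only [hu, Fin.sum_univ_three] at ht
  simpa using ht

/-- A symmetric traceless tensor that is invariant under rotations about the last axis and has
vanishing component along that axis is zero. -/
theorem eq_zero_of_axisymmetric {j : ℕ} {T : Tensor j} (hT : T ∈ spin j)
    (hL : tensorEps j ![0, 0, 1] T = 0) (h2 : component T 0 0 = 0) : T = 0 := by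
  have hrec : ∀ p q, p + q ≤ j →
      (p : ℝ) * component T (p - 1) (q + 1) = q * component T (p + 1) (q - 1) := by
    intro p q h
    have h3 := component_eps_two hT h
    rw [hL] at h3
    have h4 : component (0 : Tensor j) p q = 0 := rfl
    linarith
  have hrow : ∀ p, p ≤ j → component T p 0 = 0 := by
    intro p
    induction p using Nat.strong_induction_on with
    | _ p ih =>
      intro hp
      match p, ih, hp with
      | 0, _, _ => exact h2
      | 1, _, hp =>
        have := hrec 0 1 (by omega)
        simpa using this.symm
      | p + 2, ih, hp =>
        -- Axial invariance gives `(p + 1) T(p, 2) = T(p + 2, 0)`, while the trace and the induction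
        -- hypothesis give `T(p, 2) = -T(p + 2, 0)`; together `(p + 2) T(p + 2, 0) = 0`.
        have e1 := hrec (p + 1) 1 (by omega)
        have e2 := component_trace hT (p := p) (q := 0) (by omega)
        rw [ih p (by omega) (by omega)] at e2
        simp only [Nat.add_sub_cancel, Nat.sub_self] at e1
        push_cast at e1
        norm_num at e1 e2
        have e3 : component T p 2 = -component T (p + 2) 0 := by linarith
        rw [e3] at e1
        have e4 : ((p : ℝ) + 2) * component T (p + 2) 0 = 0 := by linarith
        exact (mul_eq_zero.1 e4).resolve_left (by positivity)
  -- Axial invariance trades two ones for two zeros, descending to `q = 0`, settled by `hrow`, or to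
  -- `q = 1`, where the recursion has right-hand side zero.
  refine eq_zero_of_component hT fun p q => ?_
  induction q using Nat.strong_induction_on generalizing p with
  | _ q ih =>
    intro h
    match q, ih, h with
    | 0, _, h => exact hrow p (by omega)
    | 1, _, h =>
      have := hrec (p + 1) 0 (by omega)
      simp only [Nat.add_sub_cancel, Nat.cast_zero, zero_mul] at this
      exact (mul_eq_zero.1 this).resolve_left (by positivity)
    | q + 2, ih, h =>
      have := hrec (p + 1) (q + 1) (by omega)
      simp only [Nat.add_sub_cancel] at this
      rw [ih q (by omega) _ (by omega), mul_zero] at this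
      exact (mul_eq_zero.1 this).resolve_left (by positivity)

/-- A space of symmetric traceless tensors stable under infinitesimal rotations on which the
component along the last axis vanishes is zero. -/
theorem eq_zero_of_invariant {j : ℕ} (W : Submodule ℝ (Spin j))
    (hW : ∀ u : Vec, ∀ T ∈ W, eps j u T ∈ W) (h2 : ∀ T ∈ W, component T.1 0 0 = 0)
    {T : Spin j} (hT : T ∈ W) : T = 0 := by
  -- Induction on the number of indices different from `2`, for all `T ∈ W` at once. A component of
  -- a rotated tensor, again in `W`, contains the next component of `T` with coefficient `± (j - p -
  -- q)`, nonzero as long as a slot with a two remains.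
  have key : ∀ n p q, p + q = n → n ≤ j → ∀ T ∈ W, component T.1 p q = 0 := by
    intro n
    induction n using Nat.strong_induction_on with
    | _ n ih =>
      intro p q hn hj T hT
      match p, q, hn with
      | 0, 0, _ => exact h2 T hT
      | p + 1, q, hn =>
        have e1 := component_eps_one T.2 (p := p) (q := q) (by omega)
        have e2 := ih (p + q) (by omega) p q rfl (by omega) _ (hW ![0, 1, 0] T hT)
        change component (tensorEps j ![0, 1, 0] T.1) p q = 0 at e2
        have e3 : (p : ℝ) * component T.1 (p - 1) q = 0 := by
          rcases p with _ | p
          · simp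
          · rw [ih _ (by omega) _ _ rfl (by omega) T hT, mul_zero]
        rw [e2, e3] at e1
        have e4 : (j : ℝ) - p - q ≠ 0 := by
          have : ((p + q + 1 : ℕ) : ℝ) ≤ j := by exact_mod_cast (by omega)
          push_cast at this
          linarith
        have e5 : ((j : ℝ) - p - q) * component T.1 (p + 1) q = 0 := by linarith
        exact (mul_eq_zero.1 e5).resolve_left e4
      | 0, q + 1, hn =>
        have e1 := component_eps_zero T.2 (p := 0) (q := q) (by omega)
        have e2 := ih q (by omega) 0 q (by omega) (by omega) _ (hW ![1, 0, 0] T hT)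
        change component (tensorEps j ![1, 0, 0] T.1) 0 q = 0 at e2
        have e3 : (q : ℝ) * component T.1 0 (q - 1) = 0 := by
          rcases q with _ | q
          · simp
          · rw [ih _ (by omega) _ _ rfl (by omega) T hT, mul_zero]
        rw [e2, e3] at e1
        have e4 : (j : ℝ) - (0 : ℕ) - q ≠ 0 := by
          have : ((q + 1 : ℕ) : ℝ) ≤ j := by exact_mod_cast (by omega)
          push_cast at this ⊢
          linarith
        have e5 : ((j : ℝ) - (0 : ℕ) - q) * component T.1 0 (q + 1) = 0 := by linarith
        exact (mul_eq_zero.1 e5).resolve_left e4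
  exact Subtype.ext (eq_zero_of_component T.2 fun p q h => key _ p q rfl h T hT)

/-! ### The rotation algebra on symmetric traceless tensors -/

/-- The cross product with `u` in the `i`-th index of a tensor. -/
def slotEps {j : ℕ} (i : Fin j) (u : Vec) (T : Tensor j) : Tensor j :=
  fun a => (crossProduct u (fun d => T (Function.update a i d))) (a i)

theorem tensorEps_eq_sum {j : ℕ} (u : Vec) (T : Tensor j) :
    tensorEps j u T = ∑ i, slotEps i u T := by
  ext a
  simp [tensorEps_apply, slotEps]

theorem slotEps_sum {j : ℕ} (i : Fin j) (u : Vec) (f : Fin j → Tensor j) :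
    slotEps i u (∑ k, f k) = ∑ k, slotEps i u (f k) := by
  ext a
  have h : (fun d => (∑ k, f k) (Function.update a i d))
      = ∑ k, fun d => f k (Function.update a i d) := by
    ext d
    simp
  rw [slotEps, h, map_sum]
  simp [slotEps]

theorem slotEps_slotEps_of_ne {j : ℕ} {i k : Fin j} (h : i ≠ k) (u w : Vec) (T : Tensor j) :
    slotEps i u (slotEps k w T) = slotEps k w (slotEps i u T) := by
  ext a
  simp only [slotEps, Function.update_of_ne h, Function.update_of_ne h.symm]
  simp only [Function.update_comm h.symm]
  generalize a i = c
  generalize a k = d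
  fin_cases c <;> fin_cases d <;> simp [cross_apply] <;> ring

theorem slotEps_slotEps_sub {j : ℕ} (i : Fin j) (u w : Vec) (T : Tensor j) :
    slotEps i u (slotEps i w T) - slotEps i w (slotEps i u T)
      = slotEps i (crossProduct u w) T := by
  ext a
  simp only [slotEps, Function.update_idem, Function.update_self, Pi.sub_apply]
  generalize a i = c
  fin_cases c <;> simp [cross_apply] <;> ring

/-- Operators in different slots commute, so only the diagonal terms survive, and in each slot these
are the Jacobi identity for the cross product. -/
theorem tensorEps_comm {j : ℕ} (u w : Vec) (T : Tensor j) :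
    tensorEps j u (tensorEps j w T) - tensorEps j w (tensorEps j u T)
      = tensorEps j (crossProduct u w) T := by
  simp only [tensorEps_eq_sum, slotEps_sum]
  rw [Finset.sum_comm (f := fun i k => slotEps i w (slotEps k u T)), ← Finset.sum_sub_distrib]
  refine Finset.sum_congr rfl fun i _ => ?_
  rw [← Finset.sum_sub_distrib, Finset.sum_eq_single i, slotEps_slotEps_sub]
  · intro k _ hk
    rw [slotEps_slotEps_of_ne hk.symm, sub_self]
  · simp

/-- The infinitesimal rotation about `u` as an endomorphism of the spin-`j` representation. -/
def rotGen (j : ℕ) : Vec →ₗ[ℝ] Module.End ℝ (Spin j) := eps j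

theorem rotGen_apply {j : ℕ} (u : Vec) (T : Spin j) : rotGen j u T = eps j u T := rfl

theorem rotGen_comm {j : ℕ} (u w : Vec) :
    rotGen j u * rotGen j w = rotGen j w * rotGen j u + rotGen j (crossProduct u w) := by
  ext1 T
  exact Subtype.ext (eq_add_of_sub_eq' (tensorEps_comm u w T.1))

/-- Two functionals that vanish on the range of `L` are proportional if the second one is
injective on the kernel of `L`. -/
theorem exists_smul_eq_of_comp_eq_zero {V : Type*} [AddCommGroup V] [Module ℝ V]
    [FiniteDimensional ℝ V] (L : V →ₗ[ℝ] V) (f ev : V →ₗ[ℝ] ℝ) (hf : f ∘ₗ L = 0)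
    (hev : ev ∘ₗ L = 0) (h : ∀ v, L v = 0 → ev v = 0 → v = 0) : ∃ c : ℝ, f = c • ev := by
  -- Both functionals lie in the kernel of the transpose, whose dimension equals that of `ker L`.
  -- The latter is at most one, because `ev` embeds `ker L` in `ℝ`.
  have hker : Module.finrank ℝ (LinearMap.ker L.dualMap) = Module.finrank ℝ (LinearMap.ker L) := by
    have h1 := L.dualMap.finrank_range_add_finrank_ker
    have h2 := L.finrank_range_add_finrank_ker
    rw [LinearMap.finrank_range_dualMap_eq_finrank_range, Subspace.dual_finrank_eq] at h1
    omega
  have hinj : Function.Injective (ev ∘ₗ (LinearMap.ker L).subtype) := by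
    rw [← LinearMap.ker_eq_bot, LinearMap.ker_eq_bot']
    rintro ⟨v, hv⟩ hv'
    exact Subtype.ext (h v hv hv')
  have hle := LinearMap.finrank_le_finrank_of_injective hinj
  rw [Module.finrank_self] at hle
  let f' : LinearMap.ker L.dualMap := ⟨f, hf⟩
  let ev' : LinearMap.ker L.dualMap := ⟨ev, hev⟩
  by_cases h0 : ev = 0
  · have h1 : Module.finrank ℝ (LinearMap.ker L.dualMap) = 0 := by
      rw [hker, Submodule.finrank_eq_zero, LinearMap.ker_eq_bot']
      intro v hv
      exact h v hv (by rw [h0]; rfl)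
    rw [Submodule.finrank_eq_zero] at h1
    have h2 : f ∈ LinearMap.ker L.dualMap := hf
    rw [h1, Submodule.mem_bot] at h2
    exact ⟨0, by rw [h2, zero_smul]⟩
  · have h1 : ev' ≠ 0 := fun h' => h0 (congrArg Subtype.val h')
    have h2 : Module.finrank ℝ (LinearMap.ker L.dualMap) = 1 := by
      have : 0 < Module.finrank ℝ (LinearMap.ker L.dualMap) :=
        Module.finrank_pos_iff_exists_ne_zero.2 ⟨ev', h1⟩
      omega
    obtain ⟨c, hc⟩ := (finrank_eq_one_iff_of_nonzero' ev' h1).1 h2 f'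
    exact ⟨c, (congrArg Subtype.val hc).symm⟩

/-- The component of a symmetric traceless tensor along the last axis. -/
def axisComponent (j : ℕ) : Spin j →ₗ[ℝ] ℝ :=
  LinearMap.proj (sortedIndex j 0 0) ∘ₗ (spin j).subtype

/-- Schur's lemma: an endomorphism that commutes with all infinitesimal rotations is scalar. -/
theorem exists_eq_smul_one {j : ℕ} (S : Module.End ℝ (Spin j))
    (hS : ∀ u, rotGen j u * S = S * rotGen j u) : ∃ c : ℝ, S = c • 1 := by
  -- Rotation about the last axis does not change the component along it, so this functional kills
  -- the range of the generator; so does its composite with `S`.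
  have hev : axisComponent j ∘ₗ rotGen j ![0, 0, 1] = 0 := by
    ext T
    have := component_eps_two T.2 (p := 0) (q := 0) (by omega)
    simp only [Nat.cast_zero, zero_mul, neg_zero, add_zero] at this
    exact this
  obtain ⟨c, hc⟩ := exists_smul_eq_of_comp_eq_zero (rotGen j ![0, 0, 1]) (axisComponent j ∘ₗ S)
    (axisComponent j) (by
      have h1 : S ∘ₗ rotGen j ![0, 0, 1] = rotGen j ![0, 0, 1] ∘ₗ S := (hS _).symm
      rw [LinearMap.comp_assoc, h1, ← LinearMap.comp_assoc, hev, LinearMap.zero_comp]) hev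
    (fun T h1 h2 => Subtype.ext (eq_zero_of_axisymmetric T.2 (congrArg Subtype.val h1) h2))
  refine ⟨c, ?_⟩
  ext1 T
  -- The range of `S - c` is rotation-invariant and has zero axis component, so it is trivial.
  have h0 : (S - c • 1) T = 0 := by
    refine eq_zero_of_invariant (LinearMap.range (S - c • (1 : Module.End ℝ (Spin j)))) ?_ ?_
      (LinearMap.mem_range_self _ T)
    · rintro u _ ⟨Y, rfl⟩
      refine ⟨rotGen j u Y, ?_⟩
      have := congrArg (fun A : Module.End ℝ (Spin j) => A Y) (hS u)
      simp only [Module.End.mul_apply] at this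
      rw [← rotGen_apply]
      simp [this]
    · rintro _ ⟨Y, rfl⟩
      have := congrArg (fun A : Spin j →ₗ[ℝ] ℝ => A Y) hc
      change axisComponent j ((S - c • (1 : Module.End ℝ (Spin j))) Y) = 0
      simp only [LinearMap.comp_apply, LinearMap.smul_apply] at this
      simp [this]
  simpa [sub_eq_zero] using h0

/-- The quadratic Casimir operator `∑ₖ Lₖ²`. -/
def casimir (j : ℕ) : Module.End ℝ (Spin j) :=
  rotGen j ![1, 0, 0] * rotGen j ![1, 0, 0] + rotGen j ![0, 1, 0] * rotGen j ![0, 1, 0]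
    + rotGen j ![0, 0, 1] * rotGen j ![0, 0, 1]

theorem vec_eq (u : Vec) :
    u = u 0 • ![1, 0, 0] + u 1 • ![0, 1, 0] + u 2 • ![0, 0, 1] := by
  ext i
  fin_cases i <;> simp

/-! ### Vector operator identities in an arbitrary ring -/

section VectorOperator

variable {R : Type*} [Ring R]

/-- `L · V` is a scalar operator: in its commutator with `l₀` the `1` and `2` terms cancel. Cyclic
relabelling gives the other two axes. -/
theorem comm_dot_of_vector_operator {l₀ l₁ l₂ v₀ v₁ v₂ : R}
    (h01 : l₀ * l₁ = l₁ * l₀ + l₂) (h20 : l₂ * l₀ = l₀ * l₂ + l₁)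
    (k00 : l₀ * v₀ = v₀ * l₀) (k01 : l₀ * v₁ = v₁ * l₀ + v₂)
    (k20 : v₂ * l₀ = l₀ * v₂ + v₁) :
    l₀ * (l₀ * v₀ + l₁ * v₁ + l₂ * v₂) = (l₀ * v₀ + l₁ * v₁ + l₂ * v₂) * l₀ := by
  linear_combination (norm := noncomm_ring) l₀ * k00 + h01 * v₁ + l₁ * k01 - h20 * v₂ - l₂ * k20

/-- This is `V = L × V`. Expanding `[C, v₀] = 0` by the Leibniz rule and moving every `l` to the
left doubles the cross product; the reordering leaves the `v₀` term. -/
theorem eq_cross_of_vector_operator {l₀ l₁ l₂ v₀ v₁ v₂ c : R}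
    (hc : l₀ * l₀ + l₁ * l₁ + l₂ * l₂ = c) (hcv : c * v₀ = v₀ * c)
    (k00 : l₀ * v₀ = v₀ * l₀) (k01 : v₀ * l₁ = l₁ * v₀ + v₂)
    (k20 : l₂ * v₀ = v₀ * l₂ + v₁) (k12 : l₁ * v₂ = v₂ * l₁ + v₀)
    (k12' : v₁ * l₂ = l₂ * v₁ + v₀) :
    2 * (v₀ + l₂ * v₁) = 2 * (l₁ * v₂) := by
  subst hc
  linear_combination (norm := noncomm_ring) hcv - l₀ * k00 - k00 * l₀ + l₁ * k01 + k01 * l₁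
    - l₂ * k20 - k20 * l₂ - k12 - k12'

/-- Noncommutative double cross product: `L × (L × V) = L (L · V) - C V + L × V`. When `V = L × V`,
the outer terms cancel. -/
theorem casimir_mul_of_vector_operator {l₀ l₁ l₂ v₀ v₁ v₂ c : R}
    (hc : l₀ * l₀ + l₁ * l₁ + l₂ * l₂ = c)
    (h01 : l₀ * l₁ = l₁ * l₀ + l₂) (h20 : l₂ * l₀ = l₀ * l₂ + l₁)
    (e1 : v₁ + l₀ * v₂ = l₂ * v₀) (e2 : v₂ + l₁ * v₀ = l₀ * v₁) :
    c * v₀ = l₀ * (l₀ * v₀ + l₁ * v₁ + l₂ * v₂) := by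
  subst hc
  linear_combination (norm := noncomm_ring) l₁ * e2 - l₂ * e1 - h01 * v₁ + h20 * v₂

end VectorOperator

/-! ### Vector operators -/

/-- The null vector `(1, i, 0)`. -/
def nullVector : Fin 3 → ℂ := ![1, Complex.I, 0]

/-- The real part of the `j`-th tensor power of the null vector `(1, i, 0)`. -/
def nullTensor (j : ℕ) : Tensor j := fun a => (∏ i, nullVector (a i)).re

theorem nullTensor_mem (j : ℕ) : nullTensor j ∈ spin j := by
  refine ⟨fun σ a => ?_, fun p q hpq a => ?_⟩
  · simp only [nullTensor, Function.comp_apply]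
    rw [Equiv.prod_comp σ (fun i => nullVector (a i))]
  · have hsplit : ∀ c : Fin 3,
        ∏ i, nullVector (Function.update (Function.update a p c) q c i)
          = (∏ i ∈ (Finset.univ.erase p).erase q, nullVector (a i))
              * (nullVector c * nullVector c) := by
      intro c
      rw [← Finset.mul_prod_erase Finset.univ _ (Finset.mem_univ p),
        ← Finset.mul_prod_erase (Finset.univ.erase p) _
          (Finset.mem_erase.2 ⟨hpq.symm, Finset.mem_univ q⟩)]
      have h1 : ∏ i ∈ (Finset.univ.erase p).erase q,
          nullVector (Function.update (Function.update a p c) q c i)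
          = ∏ i ∈ (Finset.univ.erase p).erase q, nullVector (a i) := by
        refine Finset.prod_congr rfl fun i hi => ?_
        simp only [Finset.mem_erase] at hi
        simp [Function.update_of_ne hi.1, Function.update_of_ne hi.2.1]
      rw [h1]
      simp [Function.update_of_ne hpq]
      ring
    simp only [nullTensor, hsplit, ← Complex.re_sum, ← Finset.mul_sum]
    simp [Fin.sum_univ_three, nullVector]

/-- Otherwise the whole representation would vanish, yet the power of the null vector has entry `1`
at the all-zero index. -/
theorem exists_axisComponent_ne_zero (j : ℕ) : ∃ T : Spin j, component T.1 0 0 ≠ 0 := by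
  by_contra! h
  have h0 := eq_zero_of_invariant (⊤ : Submodule ℝ (Spin j)) (fun _ _ _ => trivial)
    (fun T _ => h T) (T := ⟨nullTensor j, nullTensor_mem j⟩) trivial
  have h1 := congrFun (congrArg Subtype.val h0) 0
  simp [nullTensor, nullVector] at h1

theorem rotGen_cross_basis (j : ℕ) :
    (rotGen j ![1, 0, 0] * rotGen j ![0, 1, 0]
      = rotGen j ![0, 1, 0] * rotGen j ![1, 0, 0] + rotGen j ![0, 0, 1]) ∧
    (rotGen j ![0, 1, 0] * rotGen j ![0, 0, 1]
      = rotGen j ![0, 0, 1] * rotGen j ![0, 1, 0] + rotGen j ![1, 0, 0]) ∧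
    (rotGen j ![0, 0, 1] * rotGen j ![1, 0, 0]
      = rotGen j ![1, 0, 0] * rotGen j ![0, 0, 1] + rotGen j ![0, 1, 0]) := by
  refine ⟨?_, ?_, ?_⟩ <;> rw [rotGen_comm] <;> simp [cross_apply]

theorem rotGen_commute_of_basis {j : ℕ} {S : Module.End ℝ (Spin j)}
    (h0 : rotGen j ![1, 0, 0] * S = S * rotGen j ![1, 0, 0])
    (h1 : rotGen j ![0, 1, 0] * S = S * rotGen j ![0, 1, 0])
    (h2 : rotGen j ![0, 0, 1] * S = S * rotGen j ![0, 0, 1]) (u : Vec) :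
    rotGen j u * S = S * rotGen j u := by
  rw [vec_eq u]
  simp only [map_add, map_smul, add_mul, mul_add, smul_mul_assoc, mul_smul_comm, h0, h1, h2]

/-- The Casimir operator is the constant `-j (j + 1)`. -/
theorem casimir_eq (j : ℕ) : casimir j = (-(j * (j + 1) : ℝ)) • 1 := by
  obtain ⟨h01, h12, h20⟩ := rotGen_cross_basis j
  obtain ⟨c, hc⟩ := exists_eq_smul_one (casimir j) (by
    have c0 := comm_dot_of_vector_operator (R := Module.End ℝ (Spin j)) h01 h20 rfl h01 h20
    have c1 := comm_dot_of_vector_operator (R := Module.End ℝ (Spin j)) h12 h01 rfl h12 h01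
    have c2 := comm_dot_of_vector_operator (R := Module.End ℝ (Spin j)) h20 h12 rfl h20 h12
    refine rotGen_commute_of_basis c0 ?_ ?_
    · rwa [add_rotate, add_rotate] at c1
    · rwa [add_rotate] at c2)
  obtain ⟨T, hT⟩ := exists_axisComponent_ne_zero j
  have h1 := congrArg (fun A : Module.End ℝ (Spin j) => component (A T).1 0 0) hc
  have a0 := component_eps_zero (tensorEps_mem j ![1, 0, 0] T.2) (p := 0) (q := 0) (by omega)
  have a1 := component_eps_one (tensorEps_mem j ![0, 1, 0] T.2) (p := 0) (q := 0) (by omega)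
  have a2 := component_eps_two (tensorEps_mem j ![0, 0, 1] T.2) (p := 0) (q := 0) (by omega)
  have h2 : component (casimir j T).1 0 0
      = component (tensorEps j ![1, 0, 0] (tensorEps j ![1, 0, 0] T.1)) 0 0
      + component (tensorEps j ![0, 1, 0] (tensorEps j ![0, 1, 0] T.1)) 0 0
      + component (tensorEps j ![0, 0, 1] (tensorEps j ![0, 0, 1] T.1)) 0 0 := rfl
  have h3 : component ((c • (1 : Module.End ℝ (Spin j))) T).1 0 0 = c * component T.1 0 0 := rfl
  simp only [h2, h3, a0, a1, a2] at h1
  have h4 : c = -(j * (j + 1) : ℝ) := by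
    rcases Nat.eq_zero_or_pos j with rfl | hj
    · simp at h1
      rcases h1 with h | h
      · simp [h]
      · exact absurd h hT
    have b0 := component_eps_zero T.2 (p := 0) (q := 1) (by omega)
    have b1 := component_eps_one T.2 (p := 1) (q := 0) (by omega)
    rw [zero_add, b0, b1] at h1
    -- Turning `T(2, 0) + T(0, 2)` into `-T(0, 0)` needs two slots; for `j = 1` that sum has
    -- coefficient `j - 1 = 0`.
    rcases Nat.lt_or_ge 1 j with h2j | h2j
    · have ht := component_trace T.2 (p := 0) (q := 0) (by omega)
      push_cast at h1
      simp only [zero_add] at h1 ht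
      have h5 : (c + j * (j + 1)) * component T.1 0 0 = 0 := by
        linear_combination -h1 + (j : ℝ) * (j - 1) * ht
      linarith [(mul_eq_zero.1 h5).resolve_right hT]
    · obtain rfl : j = 1 := by omega
      push_cast at h1
      have h5 : (c + 2) * component T.1 0 0 = 0 := by
        linear_combination -h1
      push_cast
      linarith [(mul_eq_zero.1 h5).resolve_right hT]
  rw [hc, h4]

/-- A vector operator on the spin-`j` representation is a multiple of the rotation generators. -/
theorem exists_eq_smul_rotGen {j : ℕ} (hj : 1 ≤ j) (φ : Vec →ₗ[ℝ] Module.End ℝ (Spin j))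
    (hφ : ∀ u w, rotGen j w * φ u = φ u * rotGen j w + φ (crossProduct w u)) :
    ∃ c : ℝ, ∀ u, φ u = c • rotGen j u := by
  have hk : ∀ u w z : Vec, crossProduct w u = z →
      rotGen j w * φ u = φ u * rotGen j w + φ z := by
    rintro u w _ rfl
    exact hφ u w
  have hk' : ∀ u w z : Vec, crossProduct u w = z →
      φ u * rotGen j w = rotGen j w * φ u + φ z := by
    rintro u w _ rfl
    rw [hφ, add_assoc, ← map_add, ← cross_anticomm u w, neg_add_cancel, map_zero, add_zero]
  have hz : φ 0 = 0 := map_zero φ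
  have k00 := hk ![1, 0, 0] ![1, 0, 0] 0 (by simp)
  have k11 := hk ![0, 1, 0] ![0, 1, 0] 0 (by simp)
  have k22 := hk ![0, 0, 1] ![0, 0, 1] 0 (by simp)
  have k01 := hk ![0, 1, 0] ![1, 0, 0] ![0, 0, 1] (by simp [cross_apply])
  have k12 := hk ![0, 0, 1] ![0, 1, 0] ![1, 0, 0] (by simp [cross_apply])
  have k20 := hk ![1, 0, 0] ![0, 0, 1] ![0, 1, 0] (by simp [cross_apply])
  have k01' := hk' ![1, 0, 0] ![0, 1, 0] ![0, 0, 1] (by simp [cross_apply])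
  have k12' := hk' ![0, 1, 0] ![0, 0, 1] ![1, 0, 0] (by simp [cross_apply])
  have k20' := hk' ![0, 0, 1] ![1, 0, 0] ![0, 1, 0] (by simp [cross_apply])
  rw [hz, add_zero] at k00 k11 k22
  obtain ⟨h01, h12, h20⟩ := rotGen_cross_basis j
  have hC : casimir j = rotGen j ![1, 0, 0] * rotGen j ![1, 0, 0] + rotGen j ![0, 1, 0] * rotGen j ![0, 1, 0]
    + rotGen j ![0, 0, 1] * rotGen j ![0, 0, 1] := rfl
  have hC' := casimir_eq j
  generalize hl0 : rotGen j ![1, 0, 0] = l₀ at *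
  generalize hl1 : rotGen j ![0, 1, 0] = l₁ at *
  generalize hl2 : rotGen j ![0, 0, 1] = l₂ at *
  generalize hv0 : φ ![1, 0, 0] = v₀ at *
  generalize hv1 : φ ![0, 1, 0] = v₁ at *
  generalize hv2 : φ ![0, 0, 1] = v₂ at *
  generalize casimir j = C at *
  have hcomm : ∀ A : Module.End ℝ (Spin j), C * A = A * C := by
    intro A
    rw [hC']
    simp
  have htwo : ∀ A B : Module.End ℝ (Spin j), 2 * A = 2 * B → A = B := by
    intro A B h
    rw [two_mul, two_mul, ← two_smul ℝ A, ← two_smul ℝ B] at h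
    exact smul_right_injective _ (two_ne_zero' ℝ) h
  -- The three components of `V = L × V`, then of `C V = L (L · V)`, then the commutation of `L · V`
  -- with the generators.
  have e0 := htwo _ _ (eq_cross_of_vector_operator hC.symm (hcomm v₀) k00 k01' k20 k12 k12')
  have e1 := htwo _ _ (eq_cross_of_vector_operator (by rw [hC]; abel) (hcomm v₁) k11 k12' k01 k20 k20')
  have e2 := htwo _ _ (eq_cross_of_vector_operator (by rw [hC]; abel) (hcomm v₂) k22 k20' k12 k01 k01')
  have s0 := casimir_mul_of_vector_operator hC.symm h01 h20 e1 e2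
  have s1 := casimir_mul_of_vector_operator (c := C) (by rw [hC]; abel) h12 h01 e2 e0
  have s2 := casimir_mul_of_vector_operator (c := C) (by rw [hC]; abel) h20 h12 e0 e1
  have c0 := comm_dot_of_vector_operator (R := Module.End ℝ (Spin j)) h01 h20 k00 k01 k20'
  have c1 := comm_dot_of_vector_operator (R := Module.End ℝ (Spin j)) h12 h01 k11 k12 k01'
  have c2 := comm_dot_of_vector_operator (R := Module.End ℝ (Spin j)) h20 h12 k22 k20 k12'
  have r1 : l₁ * v₁ + l₂ * v₂ + l₀ * v₀ = l₀ * v₀ + l₁ * v₁ + l₂ * v₂ := by abel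
  have r2 : l₂ * v₂ + l₀ * v₀ + l₁ * v₁ = l₀ * v₀ + l₁ * v₁ + l₂ * v₂ := by abel
  rw [r1] at s1 c1
  rw [r2] at s2 c2
  obtain ⟨s, hs⟩ := exists_eq_smul_one (l₀ * v₀ + l₁ * v₁ + l₂ * v₂) (by
    subst hl0 hl1 hl2
    exact rotGen_commute_of_basis c0 c1 c2)
  rw [hs, hC'] at s0 s1 s2
  have hne : (-(j * (j + 1) : ℝ)) ≠ 0 := by
    have : (1 : ℝ) ≤ j := by exact_mod_cast hj
    nlinarith
  -- With `L · V = s`, the relation `C V = s L` is divided by the Casimir value, nonzero since `j ≥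
  -- 1`.
  refine ⟨(-(j * (j + 1) : ℝ))⁻¹ * s, fun u => ?_⟩
  generalize (-(j * (j + 1) : ℝ)) = c at *
  simp only [smul_mul_assoc, one_mul, mul_smul_comm, mul_one] at s0 s1 s2
  conv_lhs => rw [vec_eq u]
  conv_rhs => rw [vec_eq u]
  simp only [map_add, map_smul, hl0, hl1, hl2, hv0, hv1, hv2]
  rw [mul_smul, eq_inv_smul_iff₀ hne]
  simp only [smul_add, smul_comm c, smul_comm s, s0, s1, s2]

/-- The kernel is an ideal for the cross product. If it contains `u`, the identity `u × (u × w) = (u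
· w) u - |u|² w` puts `|u|² w` in it for every `w`; for `u ≠ 0` all generators vanish, contradicting
the nonzero Casimir. -/
theorem rotGen_injective {j : ℕ} (hj : 1 ≤ j) : Function.Injective (rotGen j) := by
  rw [injective_iff_map_eq_zero]
  intro u hu
  have h1 : ∀ w, rotGen j (crossProduct u w) = 0 := by
    intro w
    have h := rotGen_comm (j := j) u w
    rwa [hu, zero_mul, mul_zero, zero_add, eq_comm] at h
  have h2 : ∀ w, rotGen j (crossProduct u (crossProduct u w)) = 0 := fun w => h1 _
  have h3 : ∀ w, (u ⬝ᵥ u) • rotGen j w = 0 := by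
    intro w
    have h4 : crossProduct u (crossProduct u w) + (u ⬝ᵥ u) • w = (u ⬝ᵥ w) • u := by
      ext i
      fin_cases i <;> simp [cross_apply, dotProduct, Fin.sum_univ_three] <;> ring
    have h5 := congrArg (rotGen j) h4
    rwa [map_add, map_smul, map_smul, hu, h2, smul_zero, zero_add] at h5
  by_contra hne
  have h6 : ∀ w, rotGen j w = 0 := fun w =>
    (smul_eq_zero.1 (h3 w)).resolve_left fun h => hne (dotProduct_self_eq_zero.1 h)
  have h7 := casimir_eq j
  simp only [casimir, h6, mul_zero, add_zero] at h7
  obtain ⟨T, hT⟩ := exists_axisComponent_ne_zero j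
  have h8 := congrArg (fun A : Module.End ℝ (Spin j) => component (A T).1 0 0) h7
  have h9 : (0 : ℝ) = (-(j * (j + 1) : ℝ)) * component T.1 0 0 := h8
  have : (1 : ℝ) ≤ j := by exact_mod_cast hj
  rcases mul_eq_zero.1 h9.symm with h | h
  · nlinarith
  · exact hT h

/-! ### Rotations about the coordinate axes -/

/-- The unit vector along the `k`-th axis. -/
def axis (k : Fin 3) : Vec := Pi.single k 1

/-- The matrix of the cross product with the `k`-th unit vector. -/
def crossMatrix : Fin 3 → Matrix (Fin 3) (Fin 3) ℝ :=
  ![!![0, 0, 0; 0, 0, -1; 0, 1, 0], !![0, 0, 1; 0, 0, 0; -1, 0, 0], !![0, -1, 0; 1, 0, 0; 0, 0, 0]]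

/-- The matrix of the rotation by the angle `t` about the `k`-th axis. -/
noncomputable def axisRotation (k : Fin 3) (t : ℝ) : Matrix (Fin 3) (Fin 3) ℝ :=
  (![!![1, 0, 0; 0, Real.cos t, -Real.sin t; 0, Real.sin t, Real.cos t],
    !![Real.cos t, 0, Real.sin t; 0, 1, 0; -Real.sin t, 0, Real.cos t],
    !![Real.cos t, -Real.sin t, 0; Real.sin t, Real.cos t, 0; 0, 0, 1]] :
    Fin 3 → Matrix (Fin 3) (Fin 3) ℝ) k

theorem cross_axis_apply (k : Fin 3) (u : Vec) (a : Fin 3) :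
    crossProduct (axis k) u a = ∑ d, crossMatrix k a d * u d := by
  fin_cases k <;> fin_cases a <;>
    simp [axis, cross_apply, crossMatrix, Fin.sum_univ_three]

theorem axial_crossMatrix (k : Fin 3) : axial (crossMatrix k) = axis k := by
  ext a
  change (![crossMatrix k 2 1, crossMatrix k 0 2, crossMatrix k 1 0] : Vec) a = axis k a
  fin_cases k <;> fin_cases a <;> simp [axis, crossMatrix]

theorem axisRotation_zero (k : Fin 3) : axisRotation k 0 = 1 := by
  ext a b
  fin_cases k <;> fin_cases a <;> fin_cases b <;> simp [axisRotation]

theorem axisRotation_mem (k : Fin 3) (t : ℝ) :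
    axisRotation k t ∈ Matrix.specialOrthogonalGroup (Fin 3) ℝ := by
  have h := Real.sin_sq_add_cos_sq t
  rw [Matrix.mem_specialOrthogonalGroup_iff, Matrix.mem_orthogonalGroup_iff]
  constructor
  · ext a b
    fin_cases k <;> fin_cases a <;> fin_cases b <;>
      simp [axisRotation, Matrix.mul_apply, Fin.sum_univ_three] <;> linarith
  · rw [Matrix.det_fin_three]
    fin_cases k <;> simp [axisRotation] <;> linarith

theorem hasDerivAt_axisRotation (k : Fin 3) (t : ℝ) (a b : Fin 3) :
    HasDerivAt (fun s => axisRotation k s a b) ((crossMatrix k * axisRotation k t) a b) t := by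
  have hs := Real.hasDerivAt_sin t
  have hc := Real.hasDerivAt_cos t
  have hn := hs.neg
  have h0 := hasDerivAt_const t (0 : ℝ)
  have h1 := hasDerivAt_const t (1 : ℝ)
  fin_cases k <;> fin_cases a <;> fin_cases b <;>
    simp [axisRotation, crossMatrix, Matrix.mul_apply, Fin.sum_univ_three] <;> assumption

theorem contDiff_axisRotation (k : Fin 3) (a b : Fin 3) :
    ContDiff ℝ ∞ (fun s => axisRotation k s a b) := by
  have hs := Real.contDiff_sin (n := ∞)
  have hc := Real.contDiff_cos (n := ∞)
  have hn := hs.neg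
  have h0 := contDiff_const (𝕜 := ℝ) (E := ℝ) (n := ∞) (c := (0 : ℝ))
  have h1 := contDiff_const (𝕜 := ℝ) (E := ℝ) (n := ∞) (c := (1 : ℝ))
  fin_cases k <;> fin_cases a <;> fin_cases b <;> simp [axisRotation] <;> assumption

/-- The rotation by the angle `t` about the `k`-th axis as an element of `SO(3)`. -/
noncomputable def axisSO3 (k : Fin 3) (t : ℝ) : SO3 := ⟨axisRotation k t, axisRotation_mem k t⟩

theorem axisSO3_zero (k : Fin 3) : axisSO3 k 0 = 1 := Subtype.ext (axisRotation_zero k)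

theorem hasDerivAt_tensorAct {j : ℕ} (k : Fin 3) (t : ℝ) (T : Tensor j) (a : Fin j → Fin 3) :
    HasDerivAt (fun s => tensorAct j (axisRotation k s) T a)
      (tensorEps j (axis k) (tensorAct j (axisRotation k t) T) a) t := by
  have h1 : HasDerivAt (fun s => tensorAct j (axisRotation k s) T a)
      (∑ b : Fin j → Fin 3, (∑ i, (∏ l ∈ Finset.univ.erase i, axisRotation k t (a l) (b l))
        • (crossMatrix k * axisRotation k t) (a i) (b i)) * T b) t := by
    simp only [tensorAct_apply]
    refine HasDerivAt.fun_sum fun b _ => HasDerivAt.mul_const ?_ _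
    exact HasDerivAt.fun_finsetProd fun i _ => hasDerivAt_axisRotation k t (a i) (b i)
  convert h1 using 1
  rw [tensorEps_apply]
  simp only [cross_axis_apply, tensorAct_apply, Finset.sum_mul, Finset.mul_sum]
  rw [Finset.sum_comm (s := (Finset.univ : Finset (Fin j → Fin 3)))]
  refine Finset.sum_congr rfl fun i _ => ?_
  rw [Finset.sum_comm]
  refine Finset.sum_congr rfl fun b _ => ?_
  have h2 : ∀ d, ∏ l, axisRotation k t (Function.update a i d l) (b l)
      = axisRotation k t d (b i) * ∏ l ∈ Finset.univ.erase i, axisRotation k t (a l) (b l) := by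
    intro d
    rw [← Finset.mul_prod_erase Finset.univ _ (Finset.mem_univ i), Function.update_self]
    congr 1
    exact Finset.prod_congr rfl fun l hl => by
      rw [Function.update_of_ne (Finset.ne_of_mem_erase hl)]
  simp only [h2, Matrix.mul_apply, smul_eq_mul, Finset.mul_sum, Finset.sum_mul]
  exact Finset.sum_congr rfl fun d _ => by ring

theorem hasDerivAt_rep {j : ℕ} (k : Fin 3) (t : ℝ) (T : Spin j) :
    HasDerivAt (fun s => rep j (axisSO3 k s) T) (eps j (axis k) (rep j (axisSO3 k t) T)) t := by
  -- A linear retraction onto `spin j` transfers the derivative from the ambient tensors to the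
  -- subspace.
  obtain ⟨P, hP⟩ := LinearMap.exists_leftInverse_of_injective (spin j).subtype
    (Submodule.ker_subtype _)
  have h1 : HasDerivAt (fun s => (rep j (axisSO3 k s) T : Tensor j))
      (eps j (axis k) (rep j (axisSO3 k t) T) : Tensor j) t :=
    hasDerivAt_pi.2 fun a => hasDerivAt_tensorAct k t T.1 a
  have h2 := (LinearMap.toContinuousLinearMap P).hasFDerivAt.comp_hasDerivAt t h1
  have h3 : ∀ S : Spin j, P S.1 = S := fun S => LinearMap.congr_fun hP S
  simpa [Function.comp_def, h3] using h2

/-- The infinitesimal rotations of pairs. -/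
def pairEps (j : ℕ) (u : Vec) : Pair j →ₗ[ℝ] Pair j := (eps j u).prodMap (eps j u)

theorem pairEps_apply {j : ℕ} (u : Vec) (h : Pair j) :
    pairEps j u h = (eps j u h.1, eps j u h.2) := rfl

theorem hasDerivAt_pairRep {j : ℕ} (k : Fin 3) (t : ℝ) (h : Pair j) :
    HasDerivAt (fun s => pairRep j (axisSO3 k s) h)
      (pairEps j (axis k) (pairRep j (axisSO3 k t) h)) t :=
  (hasDerivAt_rep k t h.1).prodMk (hasDerivAt_rep k t h.2)

theorem pairRep_one {j : ℕ} (h : Pair j) : pairRep j 1 h = h := by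
  simp [pairRep]

theorem hasDerivAt_axisRotation_mulVec (k : Fin 3) (u : Vec) :
    HasDerivAt (fun s => axisRotation k s *ᵥ u) (crossProduct (axis k) u) 0 := by
  refine hasDerivAt_pi.2 fun a => ?_
  rw [cross_axis_apply]
  have h := fun b => (hasDerivAt_axisRotation k 0 a b).mul_const (u b)
  simp only [axisRotation_zero, mul_one] at h
  exact HasDerivAt.fun_sum (u := Finset.univ) fun b _ => h b

/-! ### Local rotations -/

theorem differentiableAt_of_forall_apply {V : Type*} [NormedAddCommGroup V] [NormedSpace ℝ V]
    {f : Spacetime → Spacetime →L[ℝ] V} {x : Spacetime}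
    (h : ∀ w, DifferentiableAt ℝ (fun y => f y w) x) : DifferentiableAt ℝ f x := by
  have hd : Module.finrank ℝ Spacetime = Module.finrank ℝ (Fin 3 → ℝ) := by simp
  let e₁ := ContinuousLinearEquiv.ofFinrankEq hd
  let e₂ := (e₁.arrowCongr (1 : V ≃L[ℝ] V)).trans (ContinuousLinearEquiv.piRing (Fin 3))
  rw [← Function.id_comp f, ← e₂.symm_comp_self]
  exact e₂.symm.differentiableAt.comp x (differentiableAt_pi.2 fun i => h _)


/-- The local rotation about the `k`-th axis whose angle is an affine function. -/
noncomputable def localRotation (k : Fin 3) (c : ℝ) (l : Spacetime →L[ℝ] ℝ) (x y : Spacetime) :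
    SO3 := axisSO3 k (c + l (y - x))

section

variable (k : Fin 3) (c : ℝ) (l : Spacetime →L[ℝ] ℝ) (x : Spacetime)

theorem contDiff_localRotation (a b : Fin 3) :
    ContDiff ℝ ∞ (fun y => (localRotation k c l x y).1 a b) :=
  (contDiff_axisRotation k a b).comp (f := fun y => c + l (y - x)) (by fun_prop)

theorem isSmoothRotation_localRotation (U : Set Spacetime) :
    IsSmoothRotation U (localRotation k c l x) := fun a b =>
  (contDiff_localRotation k c l x a b).contDiffOn

theorem hasFDerivAt_angle (c : ℝ) (l : Spacetime →L[ℝ] ℝ) (x y : Spacetime) : HasFDerivAt (fun z => c + l (z - x)) l y := by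
  have h := (l.hasFDerivAt (x := y - x)).comp y ((hasFDerivAt_id y).sub_const x)
  simpa [Function.comp_def] using h.const_add c

theorem maurerCartan_localRotation (y v : Spacetime) :
    maurerCartan (localRotation k c l x) y v = l v • crossMatrix k := by
  have h1 : (Matrix.of fun a b => fderiv ℝ (fun z => (localRotation k c l x z).1 a b) y v)
      = l v • (crossMatrix k * (localRotation k c l x y).1) := by
    ext a b
    have h2 : HasFDerivAt (fun z => (localRotation k c l x z).1 a b) _ y :=
      HasDerivAt.comp_hasFDerivAt (f := fun z => c + l (z - x)) y
        (hasDerivAt_axisRotation k (c + l (y - x)) a b) (hasFDerivAt_angle c l x y)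
    rw [Matrix.of_apply, h2.fderiv]
    simp [localRotation, axisSO3, mul_comm]
  have h3 : (localRotation k c l x y).1 * ((localRotation k c l x y).1)ᵀ = 1 :=
    (Matrix.mem_orthogonalGroup_iff _ _).1
      (Matrix.mem_specialOrthogonalGroup_iff.1 (localRotation k c l x y).2).1
  change (Matrix.of fun a b => fderiv ℝ (fun z => (localRotation k c l x z).1 a b) y v)
    * ((localRotation k c l x y).1)ᵀ = _
  rw [h1, smul_mul_assoc, mul_assoc, h3, mul_one]

theorem rotateBackground_localRotation (E : Background) (y v : Spacetime) :
    rotateBackground (localRotation k c l x) E y v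
      = (axisRotation k (c + l (y - x)) *ᵥ (E y v).1,
        axisRotation k (c + l (y - x)) *ᵥ (E y v).2 - l v • axis k) := by
  change ((localRotation k c l x y).1 *ᵥ (E y v).1, (localRotation k c l x y).1 *ᵥ (E y v).2
    - axial (maurerCartan (localRotation k c l x) y v)) = _
  rw [maurerCartan_localRotation, map_smul, axial_crossMatrix]
  rfl

theorem contDiffOn_rotateBackground {U : Set Spacetime} {E : Background}
    (hE : ContDiffOn ℝ ∞ E U) :
    ContDiffOn ℝ ∞ (rotateBackground (localRotation k c l x) E) U := by
  rw [contDiffOn_clm_apply]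
  intro v
  have h1 : ContDiffOn ℝ ∞ (fun y => E y v) U := hE.clm_apply contDiffOn_const
  have h2 : ∀ u : Spacetime → Vec, ContDiffOn ℝ ∞ u U →
      ContDiffOn ℝ ∞ (fun y => axisRotation k (c + l (y - x)) *ᵥ u y) U := by
    intro u hu
    rw [contDiffOn_pi] at hu ⊢
    intro a
    exact ContDiffOn.sum (s := Finset.univ) fun b _ => (contDiff_localRotation k c l x a b).contDiffOn.mul (hu b)
  simp only [rotateBackground_localRotation]
  exact (h2 _ h1.fst).prodMk ((h2 _ h1.snd).sub contDiffOn_const)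

theorem hasFDerivAt_rotateField {j : ℕ} (H : Spacetime →L[ℝ] Pair j) :
    ∃ G : Spacetime →L[ℝ] Spacetime →L[ℝ] Pair j,
      HasFDerivAt (rotateField (localRotation k c l x) (fun _ => H)) G x ∧
      ∀ v w, G v w = l v • pairEps j (axis k) (pairRep j (axisSO3 k c) (H w)) := by
  have h1 : ∀ w, HasFDerivAt
      (fun y => rotateField (localRotation k c l x) (fun _ => H) y w)
      (l.smulRight (pairEps j (axis k) (pairRep j (axisSO3 k c) (H w)))) x := by
    intro w
    have h := HasFDerivAt.comp (f := fun z => c + l (z - x)) x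
      (hasDerivAt_pairRep k (c + l (x - x)) (H w)).hasFDerivAt (hasFDerivAt_angle c l x x)
    rw [sub_self, map_zero, add_zero] at h
    exact h.congr_fderiv (ContinuousLinearMap.ext fun v => by simp)
  have h2 : DifferentiableAt ℝ (rotateField (localRotation k c l x) (fun _ => H)) x :=
    differentiableAt_of_forall_apply fun w => (h1 w).differentiableAt
  refine ⟨_, h2.hasFDerivAt, fun v w => ?_⟩
  have h3 := h2.hasFDerivAt.clm_apply (hasFDerivAt_const w x)
  have h4 := congrArg (fun A : Spacetime →L[ℝ] Pair j => A v) (h3.unique (h1 w))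
  simpa using h4

end

/-! ### Consequences of covariance -/

/-- Serves to isolate one term of a wedge product; spacetime has dimension above one, so some
nonzero functional kills `v`. -/
theorem exists_dual_orthogonal (v : Spacetime) :
    ∃ (w : Spacetime) (f : Spacetime →L[ℝ] ℝ), f v = 0 ∧ f w = 1 := by
  have h1 : Module.finrank ℝ (ℝ ∙ v) < Module.finrank ℝ Spacetime := by
    have := finrank_span_le_card (R := ℝ) ({v} : Set Spacetime)
    simp only [Set.toFinset_singleton, Finset.card_singleton] at this
    rw [finrank_euclideanSpace, Fintype.card_fin]
    omega
  have h2 : (ℝ ∙ v)ᗮ ≠ ⊥ := fun h => by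
    rw [Submodule.orthogonal_eq_bot_iff] at h
    rw [h, finrank_top] at h1
    exact lt_irrefl _ h1
  obtain ⟨w, hw, hw0⟩ := Submodule.exists_mem_ne_zero_of_ne_bot h2
  refine ⟨(inner ℝ w w)⁻¹ • w, innerSL ℝ w, ?_, ?_⟩
  · exact Submodule.mem_orthogonal_singleton_iff_inner_left.1 hw
  · simp [hw0]

/-- A 1-form that wedges to zero with every 1-form vanishes. -/
theorem eq_zero_of_wedge_eq_zero {P Q : Type} [NormedAddCommGroup P] [NormedSpace ℝ P]
    [AddCommGroup Q] (A : Spacetime → P → Q) (h0 : ∀ v, A v 0 = 0)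
    (h : ∀ (H : Spacetime →L[ℝ] P) (v w : Spacetime), A v (H w) - A w (H v) = 0)
    (v : Spacetime) (p : P) : A v p = 0 := by
  obtain ⟨w, f, hv, hw⟩ := exists_dual_orthogonal v
  -- The test form `f ⊗ p` vanishes on `v` and equals `p` on `w`, so only `A v p` remains.
  have h1 := h (f.smulRight p) v w
  simpa [hv, hw, h0] using h1

theorem d_const {V : Type} [NormedAddCommGroup V] [NormedSpace ℝ V] (H : Spacetime →L[ℝ] V)
    (x v w : Spacetime) : d (fun _ => H) x v w = 0 := by
  rw [d_apply _ _ _ _ (differentiableAt_const _)]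
  simp

section Bilinear

variable {A P Q : Type*} [NormedAddCommGroup A] [NormedSpace ℝ A]
  [FiniteDimensional ℝ A] [NormedAddCommGroup P] [NormedSpace ℝ P] [FiniteDimensional ℝ P]
  [NormedAddCommGroup Q] [NormedSpace ℝ Q]

/-- A bilinear map on finite-dimensional spaces as a continuous bilinear map. -/
noncomputable def continuousBilinear (B : A →ₗ[ℝ] P →ₗ[ℝ] Q) : A →L[ℝ] P →L[ℝ] Q :=
  LinearMap.toContinuousLinearMap
    { toFun := fun p => LinearMap.toContinuousLinearMap (B p)
      map_add' := fun p q => ContinuousLinearMap.ext fun h => by simp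
      map_smul' := fun r p => ContinuousLinearMap.ext fun h => by simp }

theorem hasDerivAt_bilinear (B : A →ₗ[ℝ] P →ₗ[ℝ] Q) {p : ℝ → A} {q : ℝ → P}
    {p' : A} {q' : P} {t : ℝ} (hp : HasDerivAt p p' t) (hq : HasDerivAt q q' t) :
    HasDerivAt (fun s => B (p s) (q s)) (B p' (q t) + B (p t) q') t :=
  ((continuousBilinear B).hasFDerivAt.comp_hasDerivAt t hp).clm_apply hq

theorem exists_hasFDerivAt_bilinear (B : A →ₗ[ℝ] P →ₗ[ℝ] Q) {p : Spacetime → A}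
    {q : Spacetime → P} {p' : Spacetime →L[ℝ] A} {q' : Spacetime →L[ℝ] P} {x : Spacetime}
    (hp : HasFDerivAt p p' x) (hq : HasFDerivAt q q' x) :
    ∃ D : Spacetime →L[ℝ] Q, HasFDerivAt (fun y => B (p y) (q y)) D x ∧
      ∀ v, D v = B (p x) (q' v) + B (p' v) (q x) :=
  ⟨_, ((continuousBilinear B).hasFDerivAt.comp x hp).clm_apply hq, fun _ => rfl⟩

end Bilinear

section

variable {j : ℕ} {U : Set Spacetime} {E : Background} {M : Coupling j}

/-- Covariance at `x` for constant `H`, with the wedge by `H` stripped off. The angle and its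
differential at `x` are the free data `c` and `l`; the term `l v • pairEps` comes from
differentiating the rotated field. -/
theorem IsSO3Covariant.coupling_localRotation (hM : IsSO3Covariant U E M) {x : Spacetime}
    (hx : x ∈ U) (k : Fin 3) (c : ℝ) (l : Spacetime →L[ℝ] ℝ) (v : Spacetime) (h : Pair j) :
    M (axisRotation k c *ᵥ (E x v).1, axisRotation k c *ᵥ (E x v).2 - l v • axis k)
        (pairRep j (axisSO3 k c) h) + l v • pairEps j (axis k) (pairRep j (axisSO3 k c) h)
      = pairRep j (axisSO3 k c) (M (E x v) h) := by
  rw [← sub_eq_zero]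
  refine eq_zero_of_wedge_eq_zero (fun v h =>
    M (axisRotation k c *ᵥ (E x v).1, axisRotation k c *ᵥ (E x v).2 - l v • axis k)
        (pairRep j (axisSO3 k c) h) + l v • pairEps j (axis k) (pairRep j (axisSO3 k c) h)
      - pairRep j (axisSO3 k c) (M (E x v) h)) (fun v => by simp) (fun H v w => ?_) v h
  have h1 := hM (localRotation k c l x) (isSmoothRotation_localRotation k c l x U)
    (fun _ => H) contDiffOn_const x hx v w
  obtain ⟨G, hG, hG'⟩ := hasFDerivAt_rotateField k c l x H
  have h2 : localRotation k c l x x = axisSO3 k c := by simp [localRotation]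
  have h3 : ∀ z, rotateField (localRotation k c l x) (fun _ => H) x z
      = pairRep j (axisSO3 k c) (H z) := by
    intro z
    rw [← h2]
    rfl
  simp only [fieldEq, wedge, d_apply _ _ _ _ hG.differentiableAt, hG.fderiv, hG', d_const,
    rotateBackground_localRotation, h3, h2, sub_self, map_zero, add_zero, zero_add, map_sub]
    at h1
  rw [← sub_eq_zero] at h1
  rw [← h1]
  abel

theorem IsSO3Covariant.coupling_connection (hM : IsSO3Covariant U E M) (hne : U.Nonempty)
    (u : Vec) (h : Pair j) : M (0, u) h = pairEps j u h := by
  obtain ⟨x, hx⟩ := hne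
  have hk : ∀ k, M (0, axis k) h = pairEps j (axis k) h := by
    intro k
    -- Used only for a pair with `l v = 1`.
    obtain ⟨v, l, -, hl⟩ := exists_dual_orthogonal 0
    have h1 := hM.coupling_localRotation hx k 0 l v h
    have h2 : ((E x v).1, (E x v).2 - l v • axis k) = E x v - (0, axis k) := by
      rw [hl, one_smul]
      ext <;> simp
    rw [axisRotation_zero, axisSO3_zero, pairRep_one, pairRep_one, Matrix.one_mulVec,
      Matrix.one_mulVec, h2, hl, one_smul, map_sub, LinearMap.sub_apply] at h1
    rw [← sub_eq_zero] at h1 ⊢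
    rw [← neg_eq_zero, ← h1]
    abel
  have h1 : ((0, u) : Vec × Vec) = u 0 • (0, axis 0) + u 1 • (0, axis 1) + u 2 • (0, axis 2) := by
    ext i
    · simp
    · fin_cases i <;> simp [axis]
  have h2 : u = u 0 • axis 0 + u 1 • axis 1 + u 2 • axis 2 := by
    ext i
    fin_cases i <;> simp [axis]
  rw [h1]
  conv_rhs => rw [h2]
  simp only [map_add, map_smul, LinearMap.add_apply, LinearMap.smul_apply, hk]
  ext1 <;> simp [pairEps_apply]

/-- Derivative at angle zero of covariance under global rotations (`l = 0`). The `ω` part is already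
known and drops out by the commutation relations, leaving the dreibein part. -/
theorem IsSO3Covariant.coupling_vector (hM : IsSO3Covariant U E M) {x : Spacetime} (hx : x ∈ U)
    (hE : Function.Surjective (E.fst x)) (u e : Vec) (h : Pair j) :
    M (crossProduct u e, 0) h + M (e, 0) (pairEps j u h) = pairEps j u (M (e, 0) h) := by
  obtain ⟨v, rfl⟩ := hE e
  have hk : ∀ k, M (crossProduct (axis k) (E x v).1, 0) h + M ((E x v).1, 0) (pairEps j (axis k) h)
      = pairEps j (axis k) (M ((E x v).1, 0) h) := by
    intro k
    have h1 := hasDerivAt_bilinear M ((hasDerivAt_axisRotation_mulVec k (E x v).1).prodMk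
      (hasDerivAt_axisRotation_mulVec k (E x v).2)) (hasDerivAt_pairRep k 0 h)
    have h2 := hasDerivAt_pairRep k 0 (M (E x v) h)
    have h3 : (fun t => M (axisRotation k t *ᵥ (E x v).1, axisRotation k t *ᵥ (E x v).2)
        (pairRep j (axisSO3 k t) h)) = fun t => pairRep j (axisSO3 k t) (M (E x v) h) := by
      funext t
      have := hM.coupling_localRotation hx k t 0 v h
      simpa using this
    rw [h3] at h1
    have h4 := h1.unique h2
    simp only [axisRotation_zero, axisSO3_zero, pairRep_one,
      Matrix.one_mulVec] at h4
    have h6 : ∀ p : Vec × Vec, ∀ q, M p q = M (p.1, 0) q + pairEps j p.2 q := by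
      intro p q
      rw [← hM.coupling_connection ⟨x, hx⟩, ← LinearMap.add_apply, ← map_add]
      simp
    have h7 : pairEps j (crossProduct (axis k) (E x v).2) h
        + pairEps j (E x v).2 (pairEps j (axis k) h)
        = pairEps j (axis k) (pairEps j (E x v).2 h) := by
      have h8 := fun T => LinearMap.congr_fun (rotGen_comm (j := j) (axis k) (E x v).2) T
      ext1
      · exact (add_comm _ _).trans (h8 h.1).symm
      · exact (add_comm _ _).trans (h8 h.2).symm
    rw [h6 (_, _), h6 (E x v), h6 (E x v), map_add, ← h7] at h4
    rw [← sub_eq_zero] at h4 ⊢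
    rw [← h4]
    dsimp only
    abel
  change M (crossProduct u (E x v).1, 0) h + M ((E x v).1, 0) (pairEps j u h)
      = pairEps j u (M ((E x v).1, 0) h)
  have h2 : u = u 0 • axis 0 + u 1 • axis 1 + u 2 • axis 2 := by
    ext i
    fin_cases i <;> simp [axis]
  have h3 : pairEps j u = u 0 • pairEps j (axis 0) + u 1 • pairEps j (axis 1)
      + u 2 • pairEps j (axis 2) := by
    conv_lhs => rw [h2]
    ext1 <;> ext1 <;> simp [pairEps]
  have h4 : ((crossProduct u (E x v).1, 0) : Vec × Vec)
      = u 0 • (crossProduct (axis 0) (E x v).1, 0) + u 1 • (crossProduct (axis 1) (E x v).1, 0)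
        + u 2 • (crossProduct (axis 2) (E x v).1, 0) := by
    conv_lhs => rw [h2]
    ext1 <;> simp
  rw [h3, h4]
  simp only [LinearMap.add_apply, LinearMap.smul_apply, ← hk, map_add, map_smul]
  module

/-- The reflection is an involution, so evaluating at reflected arguments undoes the pull-back and
leaves only the intrinsic parities. -/
theorem IsParityCovariant.coupling_parity (hM : IsParityCovariant U E M) {x : Spacetime}
    (hx : x ∈ U) (v : Spacetime) (h : Pair j) :
    M (parity (E x v)) (parity h) = parity (M (E x v) h) := by
  have hr : ∀ z : Spacetime, reflect (reflect z) = z := Submodule.reflection_reflection _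
  rw [← sub_eq_zero]
  refine eq_zero_of_wedge_eq_zero (fun v h => M (parity (E x v)) (parity h)
    - parity (M (E x v) h)) (fun v => by simp) (fun H v w => ?_) v h
  have h1 := hM (fun _ => H) contDiffOn_const (reflect x) (by simpa [hr] using hx)
    (reflect v) (reflect w)
  have h2 : parityForm (fun _ => H) = fun _ => ((parity.comp H).comp
    (reflect.toContinuousLinearEquiv : Spacetime →L[ℝ] Spacetime)) := rfl
  have h3 : ∀ z, parityForm E (reflect x) (reflect z) = parity (E x z) := by
    intro z
    change parity (E (reflect (reflect x)) (reflect (reflect z))) = _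
    rw [hr, hr]
  have h4 : ∀ z, parityForm (fun _ => H) (reflect x) (reflect z) = parity (H z) := by
    intro z
    change parity (H (reflect (reflect z))) = _
    rw [hr]
  simp only [fieldEq, wedge, h3, h4, hr, d_const, zero_add, map_sub] at h1
  rw [h2, d_const, zero_add, ← sub_eq_zero] at h1
  rw [← h1]
  abel

/-- A coupling that is covariant under rotations and parity is the frame-like one. -/
theorem exists_isFrameLike (hj : 1 ≤ j) (hs : IsSO3Covariant U E M) (hp : IsParityCovariant U E M)
    {x : Spacetime} (hx : x ∈ U) (hE : Function.Surjective (E.fst x)) :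
    ∃ a b : ℝ, IsFrameLike a b M := by
  let M₁ : Vec →ₗ[ℝ] Pair j →ₗ[ℝ] Pair j := M ∘ₗ LinearMap.inl ℝ Vec Vec
  have hv := hs.coupling_vector hx hE
  -- For an equivariant inclusion `i` and projection `p`, the block `p ∘ M (e, 0) ∘ i` is a vector
  -- operator.
  have block : ∀ (i : Spin j →ₗ[ℝ] Pair j) (p : Pair j →ₗ[ℝ] Spin j),
      (∀ u T, pairEps j u (i T) = i (eps j u T)) → (∀ u h, p (pairEps j u h) = eps j u (p h)) →
      ∃ c : ℝ, ∀ e T, p (M (e, 0) (i T)) = c • eps j e T := by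
    intro i p hi hp
    obtain ⟨c, hc⟩ := exists_eq_smul_rotGen hj
      ({ toFun := fun e => p ∘ₗ M₁ e ∘ₗ i
         map_add' := fun e e' => by ext1 T; simp
         map_smul' := fun r e => by ext1 T; simp } : Vec →ₗ[ℝ] Module.End ℝ (Spin j)) (by
      intro e u
      ext1 T
      have h1 := congrArg p (hv u e (i T))
      rw [map_add, hi, hp] at h1
      exact h1.symm.trans (add_comm _ _))
    exact ⟨c, fun e T => LinearMap.congr_fun (hc e) T⟩
  obtain ⟨α, hα⟩ := block (LinearMap.inl ℝ _ _) (LinearMap.fst ℝ _ _) (by simp [pairEps_apply])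
    (by simp [pairEps_apply])
  obtain ⟨a, ha⟩ := block (LinearMap.inr ℝ _ _) (LinearMap.fst ℝ _ _) (by simp [pairEps_apply])
    (by simp [pairEps_apply])
  obtain ⟨b, hb⟩ := block (LinearMap.inl ℝ _ _) (LinearMap.snd ℝ _ _) (by simp [pairEps_apply])
    (by simp [pairEps_apply])
  obtain ⟨β, hβ⟩ := block (LinearMap.inr ℝ _ _) (LinearMap.snd ℝ _ _) (by simp [pairEps_apply])
    (by simp [pairEps_apply])
  have hform : ∀ (e w : Vec) (h k : Spin j), M (e, w) (h, k)
      = (eps j w h + α • eps j e h + a • eps j e k, eps j w k + b • eps j e h + β • eps j e k) := by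
    intro e w h k
    have h1 : ((e, w) : Vec × Vec) = (0, w) + (e, 0) := by simp
    have h2 : ((h, k) : Pair j) = LinearMap.inl ℝ _ _ h + LinearMap.inr ℝ _ _ k := by simp
    rw [h1, map_add, LinearMap.add_apply, hs.coupling_connection ⟨x, hx⟩, pairEps_apply]
    ext1
    · change eps j w h + LinearMap.fst ℝ _ _ (M (e, 0) (h, k)) = _
      rw [h2, map_add, map_add, hα, ha, ← add_assoc]
    · change eps j w k + LinearMap.snd ℝ _ _ (M (e, 0) (h, k)) = _
      rw [h2, map_add, map_add, hb, hβ, ← add_assoc]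
  -- Diagonal blocks preserve intrinsic parity but are linear in the odd `e`, so each equals its own
  -- negative.
  have hpar : ∀ (e : Vec) (h k : Spin j), α • eps j e h = 0 ∧ β • eps j e k = 0 := by
    intro e h k
    obtain ⟨v, rfl⟩ := hE e
    have h1 := hp.coupling_parity hx v (h, k)
    have h2 : ∀ {V W : Type} [NormedAddCommGroup V] [NormedSpace ℝ V] [NormedAddCommGroup W]
      [NormedSpace ℝ W] (p : V × W), parity p = (-p.1, p.2) := fun _ => rfl
    have h3 : E x v = (E.fst x v, E.snd x v) := rfl
    rw [h2, h2, h2, h3, hform, hform] at h1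
    obtain ⟨h4, h5⟩ := Prod.ext_iff.1 h1
    simp only [map_neg, LinearMap.neg_apply, neg_neg, smul_neg] at h4 h5
    constructor
    · have h6 : (2 : ℝ) • (α • eps j (E.fst x v) h) = 0 := by
        rw [← sub_eq_zero] at h4
        rw [← h4]
        module
      exact (smul_eq_zero.1 h6).resolve_left two_ne_zero
    · have h6 : (2 : ℝ) • (β • eps j (E.fst x v) k) = 0 := by
        rw [← sub_eq_zero] at h5
        rw [← neg_eq_zero, ← h5]
        module
      exact (smul_eq_zero.1 h6).resolve_left two_ne_zero
  refine ⟨a, b, fun e w h k => ?_⟩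
  rw [hform, (hpar e h k).1, (hpar e h k).2, add_zero, add_zero]

end

/-! ### Consequences of gauge invariance -/

theorem fderiv_apply_apply {V : Type*} [NormedAddCommGroup V] [NormedSpace ℝ V]
    {F : Spacetime → Spacetime →L[ℝ] V} {x : Spacetime} (hF : DifferentiableAt ℝ F x)
    (w : Spacetime) {D : Spacetime →L[ℝ] V} (hD : HasFDerivAt (fun y => F y w) D x)
    (v : Spacetime) : fderiv ℝ F x v w = D v := by
  have h1 := hF.hasFDerivAt.clm_apply (hasFDerivAt_const w x)
  have h2 := congrArg (fun A : Spacetime →L[ℝ] V => A v) (h1.unique hD)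
  simpa using h2

section

variable {j : ℕ} {U : Set Spacetime} {E : Background} {M N : Coupling j}

/-- Invariance at `H = 0` for `Ξ y = B (y - x) + h`: slope and value at `x` are independent and
there is no second derivative. Setting `h = 0` compares `M` with `N`; setting `B = 0` gives the
background equation. -/
theorem IsGaugeInvariant.affine (hN : IsGaugeInvariant U E M N) {x : Spacetime} (hx : x ∈ U)
    (hE : DifferentiableAt ℝ E x) (B : Spacetime →L[ℝ] Pair j) (h : Pair j) (v w : Spacetime) :
    N (d E x v w) h + N (E x w) (B v) - N (E x v) (B w)
      + M (E x v) (B w + N (E x w) h) - M (E x w) (B v + N (E x v) h) = 0 := by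
  let Ξ : Spacetime → Pair j := fun y => B (y - x) + h
  have hΞ : ∀ y, HasFDerivAt Ξ B y := fun y => by
    have h1 := (B.hasFDerivAt (x := y - x)).comp y ((hasFDerivAt_id y).sub_const x)
    exact (h1.add_const h).congr_fderiv (ContinuousLinearMap.comp_id B)
  have hΞx : Ξ x = h := by simp [Ξ]
  have hg : ∀ y z, gaugeVariation N E Ξ y z = B z + N (E y z) (Ξ y) := by
    intro y z
    change fderiv ℝ Ξ y z + N (E y z) (Ξ y) = _
    rw [(hΞ y).fderiv]
  have hD : ∀ z, ∃ D : Spacetime →L[ℝ] Pair j,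
      HasFDerivAt (fun y => gaugeVariation N E Ξ y z) D x ∧
        ∀ u, D u = N (E x z) (B u) + N (fderiv ℝ E x u z) h := by
    intro z
    obtain ⟨D, hD, hD'⟩ := exists_hasFDerivAt_bilinear N
      (hE.hasFDerivAt.clm_apply (hasFDerivAt_const z x)) (hΞ x)
    refine ⟨D, ?_, fun u => ?_⟩
    · simp only [hg]
      exact hD.const_add (B z)
    · rw [hD', hΞx]
      simp
  have hdiff : DifferentiableAt ℝ (gaugeVariation N E Ξ) x :=
    differentiableAt_of_forall_apply fun z => (hD z).choose_spec.1.differentiableAt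
  have hf : ∀ u z, fderiv ℝ (gaugeVariation N E Ξ) x u z
      = N (E x z) (B u) + N (fderiv ℝ E x u z) h := by
    intro u z
    obtain ⟨D, hD, hD'⟩ := hD z
    rw [fderiv_apply_apply hdiff z hD, hD']
  have h1 := hN (fun _ => 0) contDiffOn_const Ξ (by
    have h2 : ContDiff ℝ ∞ Ξ := by fun_prop
    exact h2.contDiffOn) x hx v w
  have h2 : (fun _ => 0 : OneForm (Pair j)) + gaugeVariation N E Ξ = gaugeVariation N E Ξ :=
    zero_add _
  rw [h2] at h1
  simp only [fieldEq, wedge, d_const, d_apply _ _ _ _ hdiff, hf, hg, hΞx, zero_apply,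
    map_zero, sub_zero, add_zero] at h1
  rw [d_apply _ _ _ _ hE, map_sub, LinearMap.sub_apply, ← h1]
  abel

theorem IsGaugeInvariant.coupling_eq (hN : IsGaugeInvariant U E M N) {x : Spacetime} (hx : x ∈ U)
    (hE : DifferentiableAt ℝ E x) (v : Spacetime) (h : Pair j) :
    M (E x v) h = N (E x v) h := by
  rw [← sub_eq_zero]
  refine eq_zero_of_wedge_eq_zero (fun v h => M (E x v) h - N (E x v) h) (by simp)
    (fun B v w => ?_) v h
  have h1 := hN.affine hx hE B 0 v w
  simp only [map_zero, add_zero, zero_add] at h1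
  rw [← h1]
  abel

theorem IsGaugeInvariant.background (hN : IsGaugeInvariant U E M N) {x : Spacetime} (hx : x ∈ U)
    (hE : DifferentiableAt ℝ E x) (v w : Spacetime) (h : Pair j) :
    N (d E x v w) h + M (E x v) (N (E x w) h) - M (E x w) (N (E x v) h) = 0 := by
  have h1 := hN.affine hx hE 0 h v w
  simpa using h1

/-- A single frame compares `M` and `N` only on the values `E x v`, which do not exhaust `Vec ×
Vec`. Rotations trivial at `x` but with arbitrary differential shift `ω` freely, and surjectivity of
`e` does the rest. -/
theorem IsGaugeSystem.coupling_eq (hU : IsOpen U) (hE : ContDiffOn ℝ ∞ E U)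
    (hMN : IsGaugeSystem U E M N) {x : Spacetime} (hx : x ∈ U)
    (hs : Function.Surjective (E.fst x)) : M = N := by
  have h1 : ∀ (k : Fin 3) (l : Spacetime →L[ℝ] ℝ) (v : Spacetime) (h : Pair j),
      M (E x v - l v • (0, axis k)) h = N (E x v - l v • (0, axis k)) h := by
    intro k l v h
    have h2 := (hMN.gauge_invariant _ (isSmoothRotation_localRotation k 0 l x U)).coupling_eq hx
      (((contDiffOn_rotateBackground k 0 l x hE).contDiffAt (hU.mem_nhds hx)).differentiableAt
        (by simp)) v h
    have h3 : ((E x v).1, (E x v).2 - l v • axis k) = E x v - l v • (0, axis k) := by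
      ext <;> simp
    rwa [rotateBackground_localRotation, sub_self, map_zero, add_zero, axisRotation_zero,
      Matrix.one_mulVec, Matrix.one_mulVec, h3] at h2
  have hE' : ∀ v h, M (E x v) h = N (E x v) h := by
    intro v h
    simpa using h1 0 0 v h
  have hk : ∀ k h, M (0, axis k) h = N (0, axis k) h := by
    intro k h
    obtain ⟨v, l, -, hl⟩ := exists_dual_orthogonal 0
    have h2 := h1 k l v h
    rw [hl, one_smul, map_sub, map_sub, LinearMap.sub_apply, LinearMap.sub_apply, hE'] at h2
    exact sub_right_injective h2
  have hw : ∀ w h, M (0, w) h = N (0, w) h := by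
    intro w h
    have h3 : ((0, w) : Vec × Vec)
        = w 0 • (0, axis 0) + w 1 • (0, axis 1) + w 2 • (0, axis 2) := by
      ext i
      · simp
      · fin_cases i <;> simp [axis]
    rw [h3]
    simp only [map_add, map_smul, LinearMap.add_apply, LinearMap.smul_apply, hk]
  refine LinearMap.ext fun p => LinearMap.ext fun h => ?_
  obtain ⟨v, hv⟩ := hs p.1
  have hp : p = E x v + (0, p.2 - (E x v).2) := by
    have : (E x v).1 = p.1 := hv
    ext1 <;> simp [this]
  rw [hp, map_add, map_add, LinearMap.add_apply, LinearMap.add_apply, hE', hw]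

theorem rotateBackground_one (E : Background) : rotateBackground (localRotation 0 0 0 0) E = E := by
  funext y
  refine ContinuousLinearMap.ext fun v => ?_
  rw [rotateBackground_localRotation]
  simp [axisRotation_zero]

theorem IsGaugeSystem.backgroundEq (hU : IsOpen U) (hE : ContDiffOn ℝ ∞ E U)
    (hMN : IsGaugeSystem U E M N) (h : M = N) : BackgroundEq U E N := by
  subst h
  intro x hx v w
  have h1 := hMN.gauge_invariant _ (isSmoothRotation_localRotation 0 0 0 0 U)
  rw [rotateBackground_one] at h1
  refine LinearMap.ext fun p => ?_
  have h2 := h1.background hx ((hE.contDiffAt (hU.mem_nhds hx)).differentiableAt (by simp)) v w p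
  rw [LinearMap.zero_apply, ← h2]
  simp [add_sub_assoc]

/-! ### The frame-like equations -/

theorem d_fst {V W : Type} [NormedAddCommGroup V] [NormedSpace ℝ V] [NormedAddCommGroup W]
    [NormedSpace ℝ W] {H : OneForm (V × W)} {x : Spacetime} (hH : DifferentiableAt ℝ H x)
    (v w : Spacetime) : d H.fst x v w = (d H x v w).1 := by
  have h1 : ∀ z, HasFDerivAt (fun y => H.fst y z)
      ((ContinuousLinearMap.fst ℝ V W).comp ((fderiv ℝ H x).flip z)) x := fun z =>
    (ContinuousLinearMap.fst ℝ V W).hasFDerivAt.comp x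
      ((hH.hasFDerivAt.clm_apply (hasFDerivAt_const z x)).congr_fderiv
        (ContinuousLinearMap.ext fun u => by simp))
  have h2 : DifferentiableAt ℝ H.fst x :=
    differentiableAt_of_forall_apply fun z => (h1 z).differentiableAt
  rw [d_apply _ _ _ _ h2, d_apply _ _ _ _ hH, fderiv_apply_apply h2 _ (h1 w),
    fderiv_apply_apply h2 _ (h1 v)]
  rfl

theorem d_snd {V W : Type} [NormedAddCommGroup V] [NormedSpace ℝ V] [NormedAddCommGroup W]
    [NormedSpace ℝ W] {H : OneForm (V × W)} {x : Spacetime} (hH : DifferentiableAt ℝ H x)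
    (v w : Spacetime) : d H.snd x v w = (d H x v w).2 := by
  have h1 : ∀ z, HasFDerivAt (fun y => H.snd y z)
      ((ContinuousLinearMap.snd ℝ V W).comp ((fderiv ℝ H x).flip z)) x := fun z =>
    (ContinuousLinearMap.snd ℝ V W).hasFDerivAt.comp x
      ((hH.hasFDerivAt.clm_apply (hasFDerivAt_const z x)).congr_fderiv
        (ContinuousLinearMap.ext fun u => by simp))
  have h2 : DifferentiableAt ℝ H.snd x :=
    differentiableAt_of_forall_apply fun z => (h1 z).differentiableAt
  rw [d_apply _ _ _ _ h2, d_apply _ _ _ _ hH, fderiv_apply_apply h2 _ (h1 w),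
    fderiv_apply_apply h2 _ (h1 v)]
  rfl

theorem IsFrameLike.fieldEq_eq {a b : ℝ} (hM : IsFrameLike a b M) {H : OneForm (Pair j)}
    {x : Spacetime} (hH : DifferentiableAt ℝ H x) (v w : Spacetime) :
    fieldEq M E H x v w = frameLikeEq a b E H x v w := by
  have h1 : ∀ u z, M (E x u) (H x z) = (eps j (E.snd x u) (H.fst x z)
      + a • eps j (E.fst x u) (H.snd x z), eps j (E.snd x u) (H.snd x z)
      + b • eps j (E.fst x u) (H.fst x z)) := fun u z => hM _ _ _ _
  ext1
  · simp only [fieldEq, frameLikeEq, covD, wedge, h1, d_fst hH, Prod.fst_add, Prod.fst_sub]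
    module
  · simp only [fieldEq, frameLikeEq, covD, wedge, h1, d_snd hH, Prod.snd_add, Prod.snd_sub]
    module

theorem eps_eps (u w : Vec) (T : Spin j) :
    eps j u (eps j w T) = eps j w (eps j u T) + eps j (crossProduct u w) T :=
  LinearMap.congr_fun (rotGen_comm u w) T

theorem wedge_cross_self (α : OneForm Vec) (x v w : Spacetime) :
    wedge crossProduct α α x v w = (2 : ℝ) • crossProduct (α x v) (α x w) := by
  rw [wedge, ← cross_anticomm (α x v) (α x w), sub_neg_eq_add, two_smul]

/-- The diagonal block of the background equation: `ω` twice gives the `ω` commutator, and `e` twice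
passes through both off-diagonal blocks, giving `a * b`. Faithfulness removes the generators. -/
theorem IsFrameLike.curvature_eq (hj : 1 ≤ j) {a b : ℝ} (hM : IsFrameLike a b M)
    (hB : BackgroundEq U E M) {x : Spacetime} (hx : x ∈ U) (hE : DifferentiableAt ℝ E x)
    (v w : Spacetime) :
    curvature E x v w + (a * b / 2) • wedge crossProduct E.fst E.fst x v w = 0 := by
  refine rotGen_injective hj (LinearMap.ext fun T => ?_)
  have h1 := congrArg Prod.fst (LinearMap.congr_fun (hB x hx v w) (T, 0))
  have h2 : ∀ z, E x z = (E.fst x z, E.snd x z) := fun _ => rfl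
  have h3 : d E x v w = (d E.fst x v w, d E.snd x v w) := by rw [d_fst hE, d_snd hE]
  have h4 := eps_eps (E.fst x v) (E.fst x w) T
  have h5 := eps_eps (E.snd x v) (E.snd x w) T
  rw [h3, h2 v, h2 w] at h1
  simp only [LinearMap.add_apply, LinearMap.sub_apply, LinearMap.comp_apply, hM _ _ _ _,
    Prod.fst_add, Prod.fst_sub, map_zero, smul_zero, add_zero, zero_add, map_smul,
    LinearMap.zero_apply, Prod.fst_zero, h4, h5] at h1
  rw [rotGen_apply, curvature, wedge_cross_self, wedge_cross_self]
  simp only [map_add, map_smul, LinearMap.add_apply, LinearMap.smul_apply, map_zero,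
    LinearMap.zero_apply]
  rw [← h1]
  module

/-- The off-diagonal blocks of the background equation are `a` and `b` times the torsion, so one
nonzero constant suffices. -/
theorem IsFrameLike.torsion_eq (hj : 1 ≤ j) {a b : ℝ} (hM : IsFrameLike a b M)
    (hB : BackgroundEq U E M) (hab : a ≠ 0 ∨ b ≠ 0) {x : Spacetime} (hx : x ∈ U)
    (hE : DifferentiableAt ℝ E x) (v w : Spacetime) : torsion E x v w = 0 := by
  refine rotGen_injective hj (LinearMap.ext fun T => ?_)
  have h2 : ∀ z, E x z = (E.fst x z, E.snd x z) := fun _ => rfl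
  have h3 : d E x v w = (d E.fst x v w, d E.snd x v w) := by rw [d_fst hE, d_snd hE]
  have h4 := eps_eps (E.fst x v) (E.snd x w) T
  have h5 := eps_eps (E.snd x v) (E.fst x w) T
  have h6 := congrArg (fun u => eps j u T) (cross_anticomm (E.fst x v) (E.snd x w))
  simp only [map_neg, LinearMap.neg_apply] at h6
  rw [map_zero, LinearMap.zero_apply, rotGen_apply, torsion, wedge]
  simp only [map_add, map_sub, LinearMap.add_apply, LinearMap.sub_apply, ← h6]
  have h0 := LinearMap.congr_fun (hB x hx v w)
  rw [h3, h2 v, h2 w] at h0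
  rcases hab with ha | hb
  · have h1 := congrArg Prod.fst (h0 (0, T))
    simp only [LinearMap.add_apply, LinearMap.sub_apply, LinearMap.comp_apply, hM _ _ _ _,
      Prod.fst_add, Prod.fst_sub, map_zero, smul_zero, add_zero, zero_add, map_smul,
      LinearMap.zero_apply, Prod.fst_zero, h4, h5] at h1
    refine (smul_eq_zero.1 (Eq.trans ?_ h1)).resolve_left ha
    module
  · have h1 := congrArg Prod.snd (h0 (T, 0))
    simp only [LinearMap.add_apply, LinearMap.sub_apply, LinearMap.comp_apply, hM _ _ _ _,
      Prod.snd_add, Prod.snd_sub, map_zero, smul_zero, add_zero, zero_add, map_smul,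
      LinearMap.zero_apply, Prod.snd_zero, h4, h5] at h1
    refine (smul_eq_zero.1 (Eq.trans ?_ h1)).resolve_left hb
    module

end

end FreeHS

/-! ### The uniqueness theorem -/

theorem proposition2 (j : ℕ) (hj : 1 ≤ j)
    (U : Set FreeHS.Spacetime) (hU : IsOpen U) (hne : U.Nonempty)
    (E : FreeHS.Background) (hE : ContDiffOn ℝ ∞ E U)
    (hdreibein : ∀ x ∈ U, Function.Bijective (E.fst x))
    (M N : FreeHS.Coupling j) (hMN : FreeHS.IsGaugeSystem U E M N) :
    M = N ∧ FreeHS.BackgroundEq U E N ∧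
    ∃ a b : ℝ,
      -- the field equation is the frame-like one
      FreeHS.IsFrameLike a b M ∧
      (∀ H : FreeHS.OneForm (FreeHS.Pair j), ContDiffOn ℝ ∞ H U →
        ∀ x ∈ U, ∀ v w : FreeHS.Spacetime,
          FreeHS.fieldEq M E H x v w = FreeHS.frameLikeEq a b E H x v w) ∧
      -- the background equation in terms of curvature and torsion; it fixes `a * b`
      (∀ x ∈ U, ∀ v w : FreeHS.Spacetime,
        FreeHS.curvature E x v w
          + (a * b / 2) • FreeHS.wedge crossProduct E.fst E.fst x v w = 0) ∧
      (a ≠ 0 ∨ b ≠ 0 → ∀ x ∈ U, ∀ v w : FreeHS.Spacetime, FreeHS.torsion E x v w = 0) ∧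
      -- uniqueness on the given background
      (∀ M' N' : FreeHS.Coupling j, FreeHS.IsGaugeSystem U E M' N' →
        ∃ a' b' : ℝ, FreeHS.IsFrameLike a' b' M' ∧ a' * b' = a * b ∧
          -- for nonzero cosmological constant: unique up to the normalisation of `H_e`
          (a * b ≠ 0 → ∃ s : ℝ, s ≠ 0 ∧ ∀ (u : FreeHS.Vec × FreeHS.Vec) (h k : FreeHS.Spin j),
            M' u (s • h, k) = (s • (M u (h, k)).1, (M u (h, k)).2))) := by
  obtain ⟨x₀, hx₀⟩ := hne
  have hsurj := (hdreibein x₀ hx₀).2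
  have hdiff : ∀ {V : Type} [NormedAddCommGroup V] [NormedSpace ℝ V] {H : FreeHS.OneForm V},
      ContDiffOn ℝ ∞ H U → ∀ x ∈ U, DifferentiableAt ℝ H x := fun hH x hx =>
    (hH.contDiffAt (hU.mem_nhds hx)).differentiableAt (by simp)
  have main : ∀ M N : FreeHS.Coupling j, FreeHS.IsGaugeSystem U E M N →
      M = N ∧ FreeHS.BackgroundEq U E M ∧ ∃ a b, FreeHS.IsFrameLike a b M := by
    intro M N hMN
    have h := hMN.coupling_eq hU hE hx₀ hsurj
    exact ⟨h, by simpa only [h] using hMN.backgroundEq hU hE h,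
      FreeHS.exists_isFrameLike hj hMN.so3_covariant hMN.parity_covariant hx₀ hsurj⟩
  obtain ⟨rfl, hB, a, b, hab⟩ := main M N hMN
  refine ⟨rfl, hB, a, b, hab, fun H hH x hx v w => hab.fieldEq_eq (hdiff hH x hx) v w,
    fun x hx v w => hab.curvature_eq hj hB hx (hdiff hE x hx) v w,
    fun h x hx v w => hab.torsion_eq hj hB h hx (hdiff hE x hx) v w, fun M' N' hMN' => ?_⟩
  obtain ⟨rfl, hB', a', b', hab'⟩ := main M' N' hMN'
  -- The curvature is the same for both systems. On vectors with dreibein values along the first two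
  -- axes, `e × e` is the third axis, so its coefficients agree.
  have hprod : a' * b' = a * b := by
    obtain ⟨v, hv⟩ := hsurj ![1, 0, 0]
    obtain ⟨w, hw⟩ := hsurj ![0, 1, 0]
    have h1 := hab.curvature_eq hj hB hx₀ (hdiff hE x₀ hx₀) v w
    have h2 := hab'.curvature_eq hj hB' hx₀ (hdiff hE x₀ hx₀) v w
    rw [← h1] at h2
    have h3 := congrFun (add_left_cancel h2) 2
    rw [FreeHS.wedge_cross_self, hv, hw] at h3
    simp [cross_apply] at h3
    linarith
  refine ⟨a', b', hab', hprod, fun h0 => ?_⟩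
  have ha : a ≠ 0 := left_ne_zero_of_mul h0
  have ha' : a' ≠ 0 := left_ne_zero_of_mul (hprod ▸ h0)
  have hb : b' * (a' / a) = b := by
    field_simp
    linarith
  have hsa : a' = a' / a * a := by field_simp
  -- Rescaling `H_e` by `s` requires `a' = s a` and `b' s = b`; the first fixes `s`, and the second
  -- follows from `a' b' = a b`.
  refine ⟨a' / a, div_ne_zero ha' ha, fun ⟨e, w⟩ h k => ?_⟩
  rw [hab', hab]
  ext1
  · simp only [map_smul, smul_add, smul_smul, ← hsa]
  · simp only [map_smul, smul_smul, hb]
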